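/- **Setting.** Let $d\ge 1$, $M\ge 0$ be integers and let $\mathcal X\subseteq\mathbb R^d$ have a Lebesgue-null boundary. The target $X^*\in\mathcal X$ and the vector $\epsilon^*=(\epsilon_1^*,\dots,\epsilon_M^*)\in(0,1/2)^M$ of unknown crossover probabilities have a joint prior density $p_0(x,\epsilon)$ on $\mathcal X\times(0,1/2)^M$ with finite differential entropy (for instance, $\epsilon^*$ uniform on $(0,1/2)^M$ and independent of $X^*$). At each time $n=0,1,2,\dots$ a controller chooses a joint query $\mathbf A_n=(A_n^{(1)},\dots,A_n^{(M)})$, where each $A_n^{(m)}$ is a finite union of half-open rectangles $[a_1,b_1)\times\dots\times[a_d,b_d)\subseteq\mathcal X$, and then receives responses $\mathbf Y_{n+1}\in\{0,1\}^M$. A policy $\zeta$ prescribes $\mathbf A_n$ as a function of $\mathbf Y_1,\dots,\mathbf Y_n$; let $\mathcal F_n=\sigma(\mathbf Y_1,\dots,\mathbf Y_n)$, and let $\mathbb P^\zeta$, $\mathbb E^\zeta$ be the probability and expectation under $\zeta$. The players answer conditionally independently through memoryless binary symmetric channels: for $\mathbf y\in\{0,1\}^M$, $$\mathbb P^\zeta(\mathbf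 Y_{n+1}=\mathbf y\mid X^*=x,\epsilon^*=\epsilon,\mathcal F_n)=\prod_{m=1}^M f_{I(x\in A_n^{(m)})}(y^{(m)}\mid\epsilon_m),\qquad f_j(y\mid e)=\begin{cases}1-e,&y=j,\\ e,&y\ne j.\end{cases}$$ Let $p_{n+1}(x,\epsilon)\propto \mathbb P^\zeta(\mathbf Y_{n+1}\mid X^*=x,\epsilon^*=\epsilon,\mathcal F_n)\,p_n(x,\epsilon)$ be the normalized Bayes recursion started at $p_0$. All logarithms are to base $2$; $H$ denotes differential entropy for densities of $(x,\epsilon)$ and Shannon entropy for probability mass functions on $\{0,1\}^M$. Write $g_{i}(\mathbf y\mid\epsilon)=\prod_m f_{i_m}(y^{(m)}\mid\epsilon_m)$ for $i\in\{0,1\}^M$, $B^1=B$, $B^0=B^c$, $P_n(R,\epsilon)=\int_R p_n(x,\epsilon)\,dx$, and $C(e)=1+e\log e+(1-e)\log(1-e)$ for the capacity of the channel. For a joint query $\mathbf A$ put $$G_n(\mathbf A)=H\Big(\sum_{i\in\{0,1\}^M}\int_{(0,1/2)^M} g_i(\cdot\mid\epsilon)\,P_n\Big(\bigcap_m (A^{(m)})^{i_m},\epsilon\Big)d\epsilon\Big)-\sum_{i\in\{0,1\}^M}\int_{(0,1/2)^M}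 H(g_i(\cdot\mid\epsilon))\,P_n\Big(\bigcap_m (A^{(m)})^{i_m},\epsilon\Big)d\epsilon ,$$ and let $G_n^*=\sup_{\mathbf A}\{H(p_n)-\mathbb E[H(p_{n+1})\mid\mathbf A_n=\mathbf A,\mathcal F_n]\}$ be the maximal expected entropy loss (information gain) at time $n$, where $\mathbb E[H(p_{n+1})\mid\mathbf A_n=\mathbf A,\mathcal F_n]$ is the average of the entropy of the Bayes update of $p_n$ over the responses to $\mathbf A$, weighted by their probabilities under $p_n$. **Theorem.** For every policy $\zeta$ and every $n$, $p_n$ is the conditional density of $(X^*,\epsilon^*)$ given $\mathcal F_n$, the quantity $H(p_n)-\mathbb E^\zeta[H(p_{n+1})\mid\mathcal F_n]$ is almost surely equal to the above expected entropy loss $H(p_n)-\mathbb E[H(p_{n+1})\mid\mathbf A_n=\mathbf A,\mathcal F_n]$ at the prescribed query $\mathbf A=\mathbf A_n$, and almost surely: 1. For every joint query $\mathbf A$ the expected entropy loss $H(p_n)-\mathbb E[H(p_{n+1})\mid\mathbf A_n=\mathbf A,\mathcal F_n]$ equals $G_n(\mathbf A)$, and hence $G_n^*=\sup_{\mathbf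 A}G_n(\mathbf A)$, a finite supremum. Moreover, for every horizon $N$, a policy $\zeta$ minimizes $\mathbb E^\zeta[H(p_N)]$ over all policies if and only if for each $n<N$ its query satisfies $G_n(\mathbf A_n)=G_n^*$ almost surely. 2. $G_n^*=\sum_{m=1}^M\mathbb E^\zeta[C(\epsilon_m^*)\mid\mathcal F_n]$, where $\mathbb E^\zeta[C(\epsilon_m^*)\mid\mathcal F_n]=\int_0^{1/2}C(t)\,p_n^{(m)}(t)\,dt$ and $p_n^{(m)}$ is the marginal density of $\epsilon_m$ under $p_n$. -/

import Mathlib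

open MeasureTheory Set

noncomputable section

/-- A vector of `M` binary responses (or of `M` binary channel inputs); `true` stands for `1`. -/
abbrev Resp (M : ℕ) : Type := Fin M → Bool

/-- The space of pairs `(x, ε)`: a target location and a vector of crossover probabilities. -/
abbrev Param (d M : ℕ) : Type := (Fin d → ℝ) × (Fin M → ℝ)

/-- The open cube `(0, 1/2)^M` of crossover probabilities. -/
def epsBox (M : ℕ) : Set (Fin M → ℝ) := {e | ∀ m, e m ∈ Ioo (0 : ℝ) (1 / 2)}

/-! ### Query regions -/

/-- The half-open rectangle `[a₁, b₁) × ⋯ × [a_d, b_d)`. -/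
def rect {d : ℕ} (a b : Fin d → ℝ) : Set (Fin d → ℝ) := {x | ∀ l, a l ≤ x l ∧ x l < b l}

/-- A query region: a finite union of half-open rectangles contained in the target domain `𝒳`. -/
def IsQueryRegion {d : ℕ} (𝒳 A : Set (Fin d → ℝ)) : Prop :=
  ∃ (J : ℕ) (a b : Fin J → Fin d → ℝ),
    (∀ j l, a j l ≤ b j l) ∧ (∀ j, rect (a j) (b j) ⊆ 𝒳) ∧ A = ⋃ j, rect (a j) (b j)

/-- A joint query: one query region for each of the `M` players. -/
abbrev JointQuery {d : ℕ} (𝒳 : Set (Fin d → ℝ)) (M : ℕ) : Type :=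
  Fin M → {A : Set (Fin d → ℝ) // IsQueryRegion 𝒳 A}

/-- The regions `A⁽¹⁾, …, A⁽ᴹ⁾` of a joint query, as sets. -/
def JointQuery.regions {d M : ℕ} {𝒳 : Set (Fin d → ℝ)} (A : JointQuery 𝒳 M) :
    Fin M → Set (Fin d → ℝ) := fun m => (A m : Set (Fin d → ℝ))

/-- A policy: the joint query at time `n` is a function of the responses received up to time `n`. -/
abbrev Policy {d : ℕ} (𝒳 : Set (Fin d → ℝ)) (M : ℕ) : Type :=
  (n : ℕ) → (Fin n → Resp M) → JointQuery 𝒳 M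

/-- The cell `⋂ₘ (A⁽ᵐ⁾)^{iₘ}` of the partition induced by `A`, with `B¹ = B` and `B⁰ = Bᶜ`. -/
def cell {d M : ℕ} (A : Fin M → Set (Fin d → ℝ)) (i : Resp M) : Set (Fin d → ℝ) :=
  ⋂ m, if i m = true then A m else (A m)ᶜ

/-! ### Binary symmetric channels -/

/-- `f_j(y | e)`: the law of the output of a BSC with crossover probability `e` and input `j`. -/
def bsc (e : ℝ) (j y : Bool) : ℝ := if y = j then 1 - e else e

/-- `g_{i₁:i_M}(y | ε) = ∏ₘ f_{iₘ}(y⁽ᵐ⁾ | εₘ)`. -/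
def bscProd {M : ℕ} (e : Fin M → ℝ) (i y : Resp M) : ℝ := ∏ m, bsc (e m) (i m) (y m)

open Classical in
/-- The true answers `I(x ∈ A⁽ᵐ⁾)` to the queries. -/
def answers {d M : ℕ} (A : Fin M → Set (Fin d → ℝ)) (x : Fin d → ℝ) : Resp M :=
  fun m => decide (x ∈ A m)

/-- The likelihood of the responses `y` to the queries `A` when the parameter is `(x, ε)`. -/
def likelihood {d M : ℕ} (A : Fin M → Set (Fin d → ℝ)) (y : Resp M) (θ : Param d M) : ℝ :=
  bscProd θ.2 (answers A θ.1) y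

/-- The capacity (in bits) of a BSC, `C(e) = 1 - h_b(e)`. -/
def bscCapacity (e : ℝ) : ℝ :=
  1 - (-(e * Real.logb 2 e) - (1 - e) * Real.logb 2 (1 - e))

/-! ### Entropies (in bits) -/

/-- Shannon entropy of a probability mass function on a finite set. -/
def shannonEntropy {α : Type*} [Fintype α] (q : α → ℝ) : ℝ := -∑ a, q a * Real.logb 2 (q a)

/-- Differential entropy of a joint density of `(x, ε)`. -/
def diffEntropy {d M : ℕ} (p : Param d M → ℝ) : ℝ := -∫ θ, p θ * Real.logb 2 (p θ)

/-! ### Posteriors -/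

/-- A prior density for `(X*, ε*)` on `𝒳 × (0, 1/2)^M` whose differential entropy is finite. -/
structure IsPriorDensity {d M : ℕ} (𝒳 : Set (Fin d → ℝ)) (p : Param d M → ℝ) : Prop where
  measurable : Measurable p
  nonneg : ∀ θ, 0 ≤ p θ
  eq_zero : ∀ θ, θ ∉ 𝒳 ×ˢ epsBox M → p θ = 0
  integral_eq_one : ∫ θ, p θ = 1
  entropy_finite : Integrable (fun θ => p θ * Real.logb 2 (p θ))

/-- The probability of the responses `y` to the queries `A` when `(X*, ε*)` has density `p`. -/
def predictive {d M : ℕ} (p : Param d M → ℝ) (A : Fin M → Set (Fin d → ℝ)) (y : Resp M) : ℝ :=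
  ∫ θ, likelihood A y θ * p θ

/-- Bayes' rule: the density of `(X*, ε*)` after the responses `y` to the queries `A`. -/
def bayesUpdate {d M : ℕ} (p : Param d M → ℝ) (A : Fin M → Set (Fin d → ℝ)) (y : Resp M) :
    Param d M → ℝ := fun θ => likelihood A y θ * p θ / predictive p A y

/-- The joint posterior density `pₙ` under the policy `ζ`, given the first `n` responses. -/
def jointPosterior {d M : ℕ} {𝒳 : Set (Fin d → ℝ)} (p₀ : Param d M → ℝ) (ζ : Policy 𝒳 M) :
    (n : ℕ) → (Fin n → Resp M) → Param d M → ℝ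
  | 0, _ => p₀
  | n + 1, h =>
      bayesUpdate (jointPosterior p₀ ζ n (Fin.init h)) (ζ n (Fin.init h)).regions (h (Fin.last n))

/-- The marginal density of `ε_m` when `(X*, ε*)` has density `p`. -/
def epsMarginal {d M : ℕ} (p : Param d M → ℝ) (m : Fin M) (t : ℝ) : ℝ :=
  ∫ x : Fin d → ℝ, ∫ η : {k : Fin M // k ≠ m} → ℝ,
    p (x, fun k => if hk : k = m then t else η ⟨k, hk⟩)

/-! ### Gains -/

/-- The expected entropy loss `H(pₙ) - E[H(pₙ₊₁) | Aₙ = A, pₙ = p]`. -/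
def entropyLoss {d M : ℕ} (p : Param d M → ℝ) (A : Fin M → Set (Fin d → ℝ)) : ℝ :=
  diffEntropy p - ∑ y : Resp M, predictive p A y * diffEntropy (bayesUpdate p A y)

/-- The maximal gain `G*`: the supremum over joint queries of the expected entropy loss. -/
def maxGain {d M : ℕ} (𝒳 : Set (Fin d → ℝ)) (p : Param d M → ℝ) : ℝ :=
  ⨆ A : JointQuery 𝒳 M, entropyLoss p A.regions

/-- `P(R, ε) = ∫_R p(x, ε) dx`. -/
def regionDensity {d M : ℕ} (p : Param d M → ℝ) (R : Set (Fin d → ℝ)) (e : Fin M → ℝ) : ℝ :=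
  ∫ x in R, p (x, e)

/-- The entropy-of-mixture formula
`H(∑ᵢ ∫ gᵢ(· | ε) P(⋂ₘ (A⁽ᵐ⁾)^{iₘ}, ε) dε) - ∑ᵢ ∫ H(gᵢ(· | ε)) P(⋂ₘ (A⁽ᵐ⁾)^{iₘ}, ε) dε`. -/
def mixtureGain {d M : ℕ} (p : Param d M → ℝ) (A : Fin M → Set (Fin d → ℝ)) : ℝ :=
  shannonEntropy (fun y : Resp M =>
      ∑ i : Resp M, ∫ e in epsBox M, bscProd e i y * regionDensity p (cell A i) e)
    - ∑ i : Resp M, ∫ e in epsBox M, shannonEntropy (bscProd e i) * regionDensity p (cell A i) e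

/-! ### The observed process -/

/-- The responses `Y₁, …, Yₙ` received up to time `n`. -/
def history {Ω : Type*} {M : ℕ} (Y : ℕ → Ω → Resp M) (n : ℕ) (ω : Ω) : Fin n → Resp M :=
  fun k => Y (k + 1) ω

/-- The information `𝓕ₙ` of the joint controller at time `n`: the σ-algebra generated by
`Y₁, …, Yₙ` (the queries are functions of these). -/
abbrev obs {Ω : Type*} {M : ℕ} (Y : ℕ → Ω → Resp M) (n : ℕ) : MeasurableSpace Ω :=
  MeasurableSpace.comap (history Y n) inferInstance

/-- `μ` is a law of the target `X`, the crossover probabilities `eps` and the responses `Y` under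
the policy `ζ`: the pair `(X, eps)` has density `p₀`, and given `(X, eps)` and the first `n`
responses, the players answer the joint query of time `n` independently of each other, player `m`
through a binary symmetric channel with crossover probability `eps m`. -/
structure IsPolicyLaw {d M : ℕ} {𝒳 : Set (Fin d → ℝ)} {Ω : Type*} [MeasurableSpace Ω]
    (p₀ : Param d M → ℝ) (X : Ω → Fin d → ℝ) (eps : Ω → Fin M → ℝ) (Y : ℕ → Ω → Resp M)
    (ζ : Policy 𝒳 M) (μ : Measure Ω) : Prop where
  isProbabilityMeasure : IsProbabilityMeasure μ
  prior : μ.map (fun ω => (X ω, eps ω)) = volume.withDensity (fun θ => ENNReal.ofReal (p₀ θ))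
  response : ∀ (n : ℕ) (y : Resp M),
    μ[({ω | Y (n + 1) ω = y}).indicator (fun _ => (1 : ℝ)) |
        MeasurableSpace.comap (fun ω => (X ω, eps ω)) inferInstance ⊔ obs Y n]
      =ᵐ[μ] fun ω => likelihood (ζ n (history Y n ω)).regions y (X ω, eps ω)

end

/-! ### Binary symmetric channels and finite entropies -/

/-! The expected entropy loss of a query is the mutual information between the parameters and the
responses: the entropy of the response law minus the mean entropy of the channel noise. A symmetric
channel makes the same noise for either input, so given `ε` the noise has entropy `M - ∑ C(εₘ)`,
whatever the query and the target. Hence the loss is `H(predictive) - M + meanCapacity p`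
(`entropyLoss_eq`), the cell formula gives the same value (`mixtureGain_eq`), and since `M` bits
have entropy at most `M`, no query gains more than `meanCapacity p`.

The bound is approached by making the responses nearly uniform. Cut a query region into strips of
width `1 / K`, number them modulo `2 ^ M`, and ask player `m` for bit `m` of the residue.
Translation by `j / K` permutes the residue classes, and translation is continuous in `L¹`, so as `K
→ ∞` each class carries the fraction `2⁻ᴹ` of every integrable function
(`tendsto_setIntegral_strips`). All input vectors thus become equally likely, even jointly with `ε`;
as `gᵢ(y | ε)` sums to `1` over the inputs `i` too, the responses become uniform. Query regions
exhaust the interior of `𝒳`, and its boundary is null, so nothing is lost in the limit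
(`exists_entropyLoss_gt`).

For a horizon `N`, the mean final entropy is `H(p₀)` minus the sum of the mean losses. By the tower
property the mean of the maximal gain is `meanCapacity p₀` at every time under every policy, so
present and future gains do not compete. Policies that feed back the posterior come arbitrarily
close to this bound at all times at once, without assuming that any supremum is attained. A policy
is therefore optimal exactly if its mean loss meets the bound at each time before `N`, which, the
bound being pointwise, means almost sure equality. -/

theorem bsc_pos {e : ℝ} (he : e ∈ Ioo (0 : ℝ) (1 / 2)) (j y : Bool) : 0 < bsc e j y := by
  unfold bsc
  split_ifs
  · linarith [he.2]
  · exact he.1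

theorem sum_bsc (e : ℝ) (j : Bool) : ∑ y, bsc e j y = 1 := by
  cases j <;> simp [bsc]

theorem sum_bsc_mul_logb (e : ℝ) (j : Bool) :
    ∑ y, bsc e j y * Real.logb 2 (bsc e j y) = bscCapacity e - 1 := by
  cases j <;> simp only [bsc, bscCapacity, Fintype.sum_bool, if_true, reduceCtorEq, if_false] <;>
    ring

theorem bscProd_pos {M : ℕ} {e : Fin M → ℝ} (he : e ∈ epsBox M) (i y : Resp M) :
    0 < bscProd e i y :=
  Finset.prod_pos fun m _ => bsc_pos (he m) _ _

theorem sum_bscProd {M : ℕ} (e : Fin M → ℝ) (i : Resp M) : ∑ y, bscProd e i y = 1 := by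
  have h := Finset.prod_univ_sum (fun _ : Fin M => (Finset.univ : Finset Bool))
    (fun m b => bsc (e m) (i m) b)
  simp only [sum_bsc, Finset.prod_const_one, Fintype.piFinset_univ] at h
  exact h.symm

theorem bscProd_le_one {M : ℕ} {e : Fin M → ℝ} (he : e ∈ epsBox M) (i y : Resp M) :
    bscProd e i y ≤ 1 := by
  rw [← sum_bscProd e i]
  exact Finset.single_le_sum (f := bscProd e i) (fun y _ => (bscProd_pos he i y).le)
    (Finset.mem_univ y)

/-- Symmetry of the channel: it turns the normalization over outputs into one over inputs, which is
why uniform inputs produce uniform outputs. -/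
theorem bscProd_comm {M : ℕ} (e : Fin M → ℝ) (i y : Resp M) : bscProd e i y = bscProd e y i := by
  simp only [bscProd, bsc, eq_comm]

/-- The entropy of the response vector given its input is the sum of the binary entropies. -/
theorem shannonEntropy_bscProd {M : ℕ} {e : Fin M → ℝ} (he : e ∈ epsBox M) (i : Resp M) :
    shannonEntropy (bscProd e i) = M - ∑ m, bscCapacity (e m) := by
  -- Each term of the expanded logarithm is again a product over the players, so that its sum over
  -- `y` factors and every player but `m` contributes `1`.
  have hlog : ∀ y : Resp M, bscProd e i y * Real.logb 2 (bscProd e i y)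
      = ∑ m, ∏ k, (if k = m then bsc (e k) (i k) (y k) * Real.logb 2 (bsc (e k) (i k) (y k))
          else bsc (e k) (i k) (y k)) := by
    intro y
    have h1 : Real.logb 2 (bscProd e i y) = ∑ m, Real.logb 2 (bsc (e m) (i m) (y m)) := by
      simp only [Real.logb, bscProd, ← Finset.sum_div]
      rw [Real.log_prod fun m _ => (bsc_pos (he m) _ _).ne']
    rw [h1, Finset.mul_sum]
    refine Finset.sum_congr rfl fun m _ => ?_
    rw [bscProd, ← Finset.mul_prod_erase _ _ (Finset.mem_univ m),
      ← Finset.mul_prod_erase Finset.univ (fun k => if k = m then _ else _) (Finset.mem_univ m)]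
    have h2 : ∏ k ∈ Finset.univ.erase m,
        (if k = m then bsc (e k) (i k) (y k) * Real.logb 2 (bsc (e k) (i k) (y k))
          else bsc (e k) (i k) (y k)) = ∏ k ∈ Finset.univ.erase m, bsc (e k) (i k) (y k) :=
      Finset.prod_congr rfl fun k hk => if_neg (Finset.ne_of_mem_erase hk)
    rw [h2]
    simp only [if_true]
    ring
  have hm : ∀ m : Fin M, ∑ y : Resp M,
      ∏ k, (if k = m then bsc (e k) (i k) (y k) * Real.logb 2 (bsc (e k) (i k) (y k))
          else bsc (e k) (i k) (y k)) = bscCapacity (e m) - 1 := by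
    intro m
    have h := Finset.prod_univ_sum (fun _ : Fin M => (Finset.univ : Finset Bool))
      (fun k b => if k = m then bsc (e k) (i k) b * Real.logb 2 (bsc (e k) (i k) b)
          else bsc (e k) (i k) b)
    rw [Fintype.piFinset_univ] at h
    rw [← h, Finset.prod_eq_single m]
    · simp only [if_true]
      exact sum_bsc_mul_logb _ _
    · intro k _ hk
      simp only [if_neg hk]
      exact sum_bsc _ _
    · simp
  unfold shannonEntropy
  rw [Finset.sum_congr rfl fun y _ => hlog y, Finset.sum_comm, Finset.sum_congr rfl fun m _ => hm m]
  simp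

theorem bscCapacity_eq (e : ℝ) : bscCapacity e = 1 - Real.binEntropy e / Real.log 2 := by
  simp only [bscCapacity, Real.logb, Real.binEntropy_eq_negMulLog_add_negMulLog_one_sub,
    Real.negMulLog]
  ring

theorem continuous_bscCapacity : Continuous bscCapacity := by
  have : bscCapacity = fun e => 1 - Real.binEntropy e / Real.log 2 := funext bscCapacity_eq
  rw [this]
  fun_prop

theorem abs_bscCapacity_le_one {e : ℝ} (he : e ∈ Ioo (0 : ℝ) (1 / 2)) :
    |bscCapacity e| ≤ 1 := by
  have h2 : 0 < Real.log 2 := Real.log_pos one_lt_two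
  have h0 : 0 ≤ Real.binEntropy e / Real.log 2 :=
    div_nonneg (Real.binEntropy_nonneg he.1.le (by linarith [he.2])) h2.le
  have h1 : Real.binEntropy e / Real.log 2 ≤ 1 :=
    (div_le_one h2).2 Real.binEntropy_le_log_two
  rw [bscCapacity_eq, abs_le]
  constructor <;> linarith

theorem shannonEntropy_eq_sum_negMulLog {α : Type*} [Fintype α] (q : α → ℝ) :
    shannonEntropy q = (∑ a, Real.negMulLog (q a)) / Real.log 2 := by
  simp only [shannonEntropy, Real.logb, Real.negMulLog, Finset.sum_div, ← Finset.sum_neg_distrib]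
  exact Finset.sum_congr rfl fun a _ => by ring

/-- `t log t` extends continuously to `0`, so entropies pass to the limit whenever the finitely many
probabilities converge. -/
theorem continuous_shannonEntropy {α : Type*} [Fintype α] :
    Continuous (shannonEntropy : (α → ℝ) → ℝ) := by
  have : (shannonEntropy : (α → ℝ) → ℝ) = fun q => (∑ a, Real.negMulLog (q a)) / Real.log 2 :=
    funext shannonEntropy_eq_sum_negMulLog
  rw [this]
  fun_prop

theorem shannonEntropy_uniform (M : ℕ) :
    shannonEntropy (fun _ : Resp M => ((2 : ℝ) ^ M)⁻¹) = M := by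
  simp [shannonEntropy, Real.logb_pow]

/-- The uniform law maximizes the entropy of a vector of `M` bits. -/
theorem shannonEntropy_le {M : ℕ} {q : Resp M → ℝ} (h0 : ∀ y, 0 ≤ q y) (h1 : ∑ y, q y = 1) :
    shannonEntropy q ≤ M := by
  have hl : 0 < Real.log 2 := Real.log_pos one_lt_two
  have hK : (0 : ℝ) < 2 ^ M := by positivity
  -- Gibbs' inequality termwise: `log t ≤ t - 1` at `t = 2⁻ᴹ / q y`. The corrections `2⁻ᴹ - q y` sum
  -- to `0`.
  have key : ∀ y, Real.negMulLog (q y) ≤ q y * (M * Real.log 2) + (((2 : ℝ) ^ M)⁻¹ - q y) := by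
    intro y
    rcases (h0 y).eq_or_lt with h | h
    · simp [← h]
    · have := Real.log_le_sub_one_of_pos (show 0 < ((2 : ℝ) ^ M)⁻¹ / q y by positivity)
      rw [Real.log_div (by positivity) h.ne', Real.log_inv, Real.log_pow] at this
      have h3 := mul_le_mul_of_nonneg_left this h.le
      have h4 : q y * (((2 : ℝ) ^ M)⁻¹ / q y - 1) = ((2 : ℝ) ^ M)⁻¹ - q y := by
        field_simp
      rw [h4] at h3
      unfold Real.negMulLog
      linarith
  rw [shannonEntropy_eq_sum_negMulLog, div_le_iff₀ hl]
  refine (Finset.sum_le_sum fun y _ => key y).trans ?_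
  rw [Finset.sum_add_distrib, ← Finset.sum_mul, Finset.sum_sub_distrib, h1]
  simp

/-! ### Query regions and likelihoods -/

theorem measurableSet_rect {d : ℕ} (a b : Fin d → ℝ) : MeasurableSet (rect a b) := by
  have : rect a b = ⋂ l, (fun x : Fin d → ℝ => x l) ⁻¹' Ico (a l) (b l) := by
    ext x
    simp [rect]
  rw [this]
  exact MeasurableSet.iInter fun l => measurable_pi_apply l measurableSet_Ico

theorem IsQueryRegion.measurableSet {d : ℕ} {𝒳 A : Set (Fin d → ℝ)} (h : IsQueryRegion 𝒳 A) :
    MeasurableSet A := by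
  obtain ⟨J, a, b, -, -, rfl⟩ := h
  exact MeasurableSet.iUnion fun j => measurableSet_rect _ _

theorem JointQuery.measurableSet_regions {d M : ℕ} {𝒳 : Set (Fin d → ℝ)} (A : JointQuery 𝒳 M)
    (m : Fin M) : MeasurableSet (A.regions m) :=
  (A m).2.measurableSet

theorem measurableSet_epsBox (M : ℕ) : MeasurableSet (epsBox M) := by
  have : epsBox M = ⋂ m, (fun e : Fin M → ℝ => e m) ⁻¹' Ioo 0 (1 / 2) := by
    ext e
    simp [epsBox]
  rw [this]
  exact MeasurableSet.iInter fun m => measurable_pi_apply m measurableSet_Ioo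

theorem measurable_bscProd {M : ℕ} (i y : Resp M) :
    Measurable fun e : Fin M → ℝ => bscProd e i y := by
  unfold bscProd bsc
  refine Finset.measurable_prod _ fun m _ => ?_
  split_ifs <;> fun_prop

theorem mem_cell_iff {d M : ℕ} (A : Fin M → Set (Fin d → ℝ)) (i : Resp M) (x : Fin d → ℝ) :
    x ∈ cell A i ↔ answers A x = i := by
  simp only [cell, mem_iInter, answers, funext_iff]
  refine forall_congr' fun m => ?_
  by_cases hx : x ∈ A m <;> cases h : i m <;> simp [hx]

theorem measurableSet_cell {d M : ℕ} {A : Fin M → Set (Fin d → ℝ)} (hA : ∀ m, MeasurableSet (A m))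
    (i : Resp M) : MeasurableSet (cell A i) := by
  refine MeasurableSet.iInter fun m => ?_
  split_ifs
  exacts [hA m, (hA m).compl]

/-- Only finitely many answer vectors occur, and their cells partition the space; measurability and
Fubini arguments reduce to single cells. -/
theorem eq_sum_indicator_cell {d M : ℕ} (A : Fin M → Set (Fin d → ℝ)) (F : Resp M → ℝ)
    (x : Fin d → ℝ) : F (answers A x) = ∑ i, (cell A i).indicator (fun _ => F i) x := by
  classical
  simp only [indicator_apply, mem_cell_iff]
  simp

theorem measurable_answers_comp {d M : ℕ} {A : Fin M → Set (Fin d → ℝ)}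
    (hA : ∀ m, MeasurableSet (A m)) {F : Resp M → (Fin M → ℝ) → ℝ} (hF : ∀ i, Measurable (F i)) :
    Measurable fun θ : Param d M => F (answers A θ.1) θ.2 := by
  have : (fun θ : Param d M => F (answers A θ.1) θ.2)
      = fun θ => ∑ i, (Prod.fst ⁻¹' cell A i).indicator (fun θ : Param d M => F i θ.2) θ := by
    ext θ
    rw [eq_sum_indicator_cell A (fun i => F i θ.2)]
    exact Finset.sum_congr rfl fun i _ => rfl
  rw [this]
  refine Finset.measurable_sum _ fun i _ => ?_
  exact ((hF i).comp measurable_snd).indicator (measurable_fst (measurableSet_cell hA i))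

theorem measurable_likelihood {d M : ℕ} {A : Fin M → Set (Fin d → ℝ)}
    (hA : ∀ m, MeasurableSet (A m)) (y : Resp M) : Measurable (likelihood A y) :=
  measurable_answers_comp hA (F := fun i e => bscProd e i y) fun i => measurable_bscProd i y

theorem likelihood_pos {d M : ℕ} (A : Fin M → Set (Fin d → ℝ)) (y : Resp M) {θ : Param d M}
    (hθ : θ.2 ∈ epsBox M) : 0 < likelihood A y θ :=
  bscProd_pos hθ _ _

theorem likelihood_le_one {d M : ℕ} (A : Fin M → Set (Fin d → ℝ)) (y : Resp M) {θ : Param d M}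
    (hθ : θ.2 ∈ epsBox M) : likelihood A y θ ≤ 1 :=
  bscProd_le_one hθ _ _

theorem abs_likelihood_le_one {d M : ℕ} (A : Fin M → Set (Fin d → ℝ)) (y : Resp M) {θ : Param d M}
    (hθ : θ.2 ∈ epsBox M) : |likelihood A y θ| ≤ 1 := by
  rw [abs_of_pos (likelihood_pos A y hθ)]
  exact likelihood_le_one A y hθ

theorem sum_likelihood {d M : ℕ} (A : Fin M → Set (Fin d → ℝ)) (θ : Param d M) :
    ∑ y, likelihood A y θ = 1 :=
  sum_bscProd _ _

theorem sum_likelihood_mul_logb {d M : ℕ} (A : Fin M → Set (Fin d → ℝ)) {θ : Param d M}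
    (hθ : θ.2 ∈ epsBox M) :
    ∑ y, likelihood A y θ * Real.logb 2 (likelihood A y θ)
      = (∑ m, bscCapacity (θ.2 m)) - M := by
  have := shannonEntropy_bscProd hθ (answers A θ.1)
  unfold shannonEntropy at this
  unfold likelihood
  linarith

theorem abs_mul_logb_le {t : ℝ} (h0 : 0 ≤ t) (h1 : t ≤ 1) :
    |t * Real.logb 2 t| ≤ 1 / Real.log 2 := by
  have hl : 0 < Real.log 2 := Real.log_pos one_lt_two
  rw [Real.logb, ← mul_div_assoc, abs_div, abs_of_pos hl]
  gcongr
  rcases h0.eq_or_lt with h | h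
  · simp [← h]
  · rw [mul_comm]
    exact (Real.abs_log_mul_self_lt t h h1).le

/-! ### Densities and Bayes' rule -/

namespace IsPriorDensity

variable {d M : ℕ} {𝒳 : Set (Fin d → ℝ)} {p : Param d M → ℝ} {A : Fin M → Set (Fin d → ℝ)}

theorem integrable (hp : IsPriorDensity 𝒳 p) : Integrable p :=
  integrable_of_integral_eq_one hp.integral_eq_one

theorem mem_of_ne_zero (hp : IsPriorDensity 𝒳 p) {θ : Param d M} (h : p θ ≠ 0) :
    θ.1 ∈ 𝒳 ∧ θ.2 ∈ epsBox M := by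
  by_contra h'
  exact h (hp.eq_zero θ h')

/-- A bound on the cube of crossover probabilities suffices because the density vanishes off it.
Likelihoods and capacities are controlled only there. -/
theorem abs_mul_le (hp : IsPriorDensity 𝒳 p) {F : Param d M → ℝ} {c : ℝ}
    (hc : ∀ θ, θ.2 ∈ epsBox M → |F θ| ≤ c) (θ : Param d M) : |F θ * p θ| ≤ c * p θ := by
  by_cases h : p θ = 0
  · simp [h]
  · rw [abs_mul, abs_of_nonneg (hp.nonneg θ)]
    exact mul_le_mul_of_nonneg_right (hc θ (hp.mem_of_ne_zero h).2) (hp.nonneg θ)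

theorem integrable_mul (hp : IsPriorDensity 𝒳 p) {F : Param d M → ℝ} (hF : Measurable F) {c : ℝ}
    (hc : ∀ θ, θ.2 ∈ epsBox M → |F θ| ≤ c) : Integrable fun θ => F θ * p θ := by
  refine (hp.integrable.const_mul c).mono' (hF.mul hp.measurable).aestronglyMeasurable ?_
  exact ae_of_all _ fun θ => hp.abs_mul_le hc θ

theorem integrable_likelihood_mul (hp : IsPriorDensity 𝒳 p) (hA : ∀ m, MeasurableSet (A m))
    (y : Resp M) : Integrable fun θ => likelihood A y θ * p θ :=
  hp.integrable_mul (measurable_likelihood hA y) fun _ hθ => abs_likelihood_le_one A y hθ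

theorem likelihood_mul_nonneg (hp : IsPriorDensity 𝒳 p) (y : Resp M) (θ : Param d M) :
    0 ≤ likelihood A y θ * p θ := by
  by_cases h : p θ = 0
  · simp [h]
  · exact mul_nonneg (likelihood_pos A y (hp.mem_of_ne_zero h).2).le (hp.nonneg θ)

/-- On the open cube every response has positive likelihood, so a zero integral would force the
density to vanish almost everywhere. Hence Bayes' rule never divides by zero, for any history. -/
theorem predictive_pos (hp : IsPriorDensity 𝒳 p) (hA : ∀ m, MeasurableSet (A m)) (y : Resp M) :
    0 < predictive p A y := by
  refine lt_of_le_of_ne (integral_nonneg (hp.likelihood_mul_nonneg y)) fun h => ?_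
  have h0 := (integral_eq_zero_iff_of_nonneg (hp.likelihood_mul_nonneg y)
    (hp.integrable_likelihood_mul hA y)).1 h.symm
  have h1 : p =ᵐ[volume] 0 := by
    filter_upwards [h0] with θ hθ
    by_contra hne
    exact mul_ne_zero (likelihood_pos A y (hp.mem_of_ne_zero hne).2).ne' hne hθ
  have h2 := hp.integral_eq_one
  rw [integral_congr_ae h1] at h2
  simp at h2

theorem sum_predictive (hp : IsPriorDensity 𝒳 p) (hA : ∀ m, MeasurableSet (A m)) :
    ∑ y, predictive p A y = 1 := by
  unfold predictive
  rw [← integral_finsetSum _ fun y _ => hp.integrable_likelihood_mul hA y]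
  simp only [← Finset.sum_mul, sum_likelihood, one_mul]
  exact hp.integral_eq_one

theorem integrable_likelihood_mul_logb (hp : IsPriorDensity 𝒳 p) (hA : ∀ m, MeasurableSet (A m))
    (y : Resp M) :
    Integrable fun θ => likelihood A y θ * Real.logb 2 (likelihood A y θ) * p θ := by
  have hL := measurable_likelihood hA y
  refine hp.integrable_mul (hL.mul ?_) fun θ hθ =>
    abs_mul_logb_le (likelihood_pos A y hθ).le (likelihood_le_one A y hθ)
  exact (Real.measurable_log.comp hL).div_const _

theorem integrable_likelihood_mul_entropy (hp : IsPriorDensity 𝒳 p)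
    (hA : ∀ m, MeasurableSet (A m)) (y : Resp M) :
    Integrable fun θ => likelihood A y θ * (p θ * Real.logb 2 (p θ)) := by
  refine hp.entropy_finite.norm.mono'
    ((measurable_likelihood hA y).aestronglyMeasurable.mul
      hp.entropy_finite.aestronglyMeasurable) (ae_of_all _ fun θ => ?_)
  by_cases h : p θ = 0
  · simp [h]
  · rw [norm_mul]
    exact mul_le_of_le_one_left (norm_nonneg _)
      (abs_likelihood_le_one A y (hp.mem_of_ne_zero h).2)

/-- The logarithm of `L p / Z` splits because `L` and `Z` are positive; where `p` vanishes both
sides are `0`. -/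
theorem predictive_mul_bayesUpdate_mul_logb (hp : IsPriorDensity 𝒳 p)
    (hA : ∀ m, MeasurableSet (A m)) (y : Resp M) (θ : Param d M) :
    predictive p A y * (bayesUpdate p A y θ * Real.logb 2 (bayesUpdate p A y θ))
      = likelihood A y θ * Real.logb 2 (likelihood A y θ) * p θ
        + likelihood A y θ * (p θ * Real.logb 2 (p θ))
        - Real.logb 2 (predictive p A y) * (likelihood A y θ * p θ) := by
  have hZ := (hp.predictive_pos hA y).ne'
  by_cases h : p θ = 0
  · simp [bayesUpdate, h]
  · have hL := (likelihood_pos A y (hp.mem_of_ne_zero h).2).ne'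
    unfold bayesUpdate
    rw [Real.logb_div (mul_ne_zero hL h) hZ, Real.logb_mul hL h]
    field_simp

theorem integrable_bayesUpdate_mul_logb (hp : IsPriorDensity 𝒳 p)
    (hA : ∀ m, MeasurableSet (A m)) (y : Resp M) :
    Integrable fun θ => bayesUpdate p A y θ * Real.logb 2 (bayesUpdate p A y θ) := by
  have hZ := (hp.predictive_pos hA y).ne'
  have h := ((hp.integrable_likelihood_mul_logb hA y).add
    (hp.integrable_likelihood_mul_entropy hA y)).sub
      ((hp.integrable_likelihood_mul hA y).const_mul (Real.logb 2 (predictive p A y)))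
  refine (h.const_mul (predictive p A y)⁻¹).congr (ae_of_all _ fun θ => ?_)
  have := hp.predictive_mul_bayesUpdate_mul_logb hA y θ
  simp only [Pi.add_apply, Pi.sub_apply]
  rw [← this, inv_mul_cancel_left₀ hZ]

/-- Bayes' rule turns densities of finite entropy into densities of finite entropy. -/
theorem bayesUpdate (hp : IsPriorDensity 𝒳 p) (hA : ∀ m, MeasurableSet (A m)) (y : Resp M) :
    IsPriorDensity 𝒳 (bayesUpdate p A y) where
  measurable := ((measurable_likelihood hA y).mul hp.measurable).div_const _
  nonneg θ := div_nonneg (hp.likelihood_mul_nonneg y θ) (hp.predictive_pos hA y).le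
  eq_zero θ hθ := by simp [_root_.bayesUpdate, hp.eq_zero θ hθ]
  integral_eq_one := by
    unfold _root_.bayesUpdate
    rw [integral_div]
    exact div_self (hp.predictive_pos hA y).ne'
  entropy_finite := hp.integrable_bayesUpdate_mul_logb hA y

theorem predictive_mul_diffEntropy_bayesUpdate (hp : IsPriorDensity 𝒳 p)
    (hA : ∀ m, MeasurableSet (A m)) (y : Resp M) :
    predictive p A y * diffEntropy (_root_.bayesUpdate p A y)
      = predictive p A y * Real.logb 2 (predictive p A y)
        - ∫ θ, (likelihood A y θ * Real.logb 2 (likelihood A y θ) * p θ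
          + likelihood A y θ * (p θ * Real.logb 2 (p θ))) := by
  unfold diffEntropy
  rw [mul_neg, ← integral_const_mul]
  simp only [hp.predictive_mul_bayesUpdate_mul_logb hA y]
  have hint : Integrable fun θ => likelihood A y θ * Real.logb 2 (likelihood A y θ) * p θ
      + likelihood A y θ * (p θ * Real.logb 2 (p θ)) :=
    (hp.integrable_likelihood_mul_logb hA y).add (hp.integrable_likelihood_mul_entropy hA y)
  rw [integral_sub hint ((hp.integrable_likelihood_mul hA y).const_mul _), integral_const_mul]
  simp only [predictive]
  ring

end IsPriorDensity

/-- The mean of `∑ₘ C(εₘ)` when `(X*, ε*)` has density `p`. -/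
noncomputable def meanCapacity {d M : ℕ} (p : Param d M → ℝ) : ℝ :=
  ∫ θ, (∑ m, bscCapacity (θ.2 m)) * p θ

/-! ### The expected entropy loss as mutual information -/

namespace IsPriorDensity

variable {d M : ℕ} {𝒳 : Set (Fin d → ℝ)} {p : Param d M → ℝ} {A : Fin M → Set (Fin d → ℝ)}

theorem integrable_capacity_mul (hp : IsPriorDensity 𝒳 p) (m : Fin M) :
    Integrable fun θ => bscCapacity (θ.2 m) * p θ :=
  hp.integrable_mul (c := 1)
    (continuous_bscCapacity.measurable.comp ((measurable_pi_apply m).comp measurable_snd))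
    fun _ hθ => abs_bscCapacity_le_one (hθ m)

theorem integrable_sum_capacity_mul (hp : IsPriorDensity 𝒳 p) :
    Integrable fun θ : Param d M => (∑ m, bscCapacity (θ.2 m)) * p θ := by
  simp only [Finset.sum_mul]
  exact integrable_finsetSum _ fun m _ => hp.integrable_capacity_mul m

theorem meanCapacity_eq_sum (hp : IsPriorDensity 𝒳 p) :
    meanCapacity p = ∑ m, ∫ θ, bscCapacity (θ.2 m) * p θ := by
  unfold meanCapacity
  rw [← integral_finsetSum _ fun m _ => hp.integrable_capacity_mul m]
  simp only [Finset.sum_mul]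

/-- The expected entropy loss, in terms of the law of the responses. -/
theorem entropyLoss_eq (hp : IsPriorDensity 𝒳 p) (hA : ∀ m, MeasurableSet (A m)) :
    entropyLoss p A = shannonEntropy (predictive p A) - M + meanCapacity p := by
  have hint : ∀ y, Integrable fun θ => likelihood A y θ * Real.logb 2 (likelihood A y θ) * p θ
      + likelihood A y θ * (p θ * Real.logb 2 (p θ)) := fun y =>
    (hp.integrable_likelihood_mul_logb hA y).add (hp.integrable_likelihood_mul_entropy hA y)
  have hC := hp.integrable_sum_capacity_mul
  have hCM : Integrable fun θ : Param d M => (∑ m, bscCapacity (θ.2 m)) * p θ - M * p θ :=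
    hC.sub (hp.integrable.const_mul _)
  -- Summed over `y`, the likelihoods give `1` and the terms `L log L` give minus the noise entropy;
  -- the answers, and with them the query, drop out.
  have hsum : ∑ y, ∫ θ, (likelihood A y θ * Real.logb 2 (likelihood A y θ) * p θ
      + likelihood A y θ * (p θ * Real.logb 2 (p θ)))
      = meanCapacity p - M + ∫ θ, p θ * Real.logb 2 (p θ) := by
    rw [← integral_finsetSum _ fun y _ => hint y]
    have : ∀ θ, ∑ y, (likelihood A y θ * Real.logb 2 (likelihood A y θ) * p θ
        + likelihood A y θ * (p θ * Real.logb 2 (p θ)))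
        = ((∑ m, bscCapacity (θ.2 m)) * p θ - M * p θ) + p θ * Real.logb 2 (p θ) := by
      intro θ
      rw [Finset.sum_add_distrib, ← Finset.sum_mul, ← Finset.sum_mul, sum_likelihood, one_mul]
      by_cases h : p θ = 0
      · simp [h]
      · rw [sum_likelihood_mul_logb A (hp.mem_of_ne_zero h).2]
        ring
    simp only [this]
    rw [integral_add hCM hp.entropy_finite,
      integral_sub hC (hp.integrable.const_mul _), integral_const_mul, hp.integral_eq_one, mul_one]
    rfl
  unfold entropyLoss
  simp only [hp.predictive_mul_diffEntropy_bayesUpdate hA]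
  rw [Finset.sum_sub_distrib, hsum]
  unfold diffEntropy shannonEntropy
  ring

theorem entropyLoss_le_meanCapacity (hp : IsPriorDensity 𝒳 p) (hA : ∀ m, MeasurableSet (A m)) :
    entropyLoss p A ≤ meanCapacity p := by
  rw [hp.entropyLoss_eq hA]
  linarith [shannonEntropy_le (fun y => (hp.predictive_pos hA y).le) (hp.sum_predictive hA)]

/-- Integration over the cells of a query, by Fubini's theorem. -/
theorem sum_integral_mul_regionDensity (hp : IsPriorDensity 𝒳 p) (hA : ∀ m, MeasurableSet (A m))
    {F : Resp M → (Fin M → ℝ) → ℝ} (hF : ∀ i, Measurable (F i)) {c : ℝ}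
    (hc : ∀ i, ∀ e ∈ epsBox M, |F i e| ≤ c) :
    ∑ i, ∫ e in epsBox M, F i e * regionDensity p (cell A i) e
      = ∫ θ, F (answers A θ.1) θ.2 * p θ := by
  have hint : ∀ i, Integrable
      fun θ : Param d M => (Prod.fst ⁻¹' cell A i).indicator (fun θ => F i θ.2 * p θ) θ :=
    fun i => (hp.integrable_mul ((hF i).comp measurable_snd)
      fun θ hθ => hc i θ.2 hθ).indicator (measurable_fst (measurableSet_cell hA i))
  have hR : ∀ θ : Param d M, F (answers A θ.1) θ.2 * p θ
      = ∑ i, (Prod.fst ⁻¹' cell A i).indicator (fun θ => F i θ.2 * p θ) θ := by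
    intro θ
    rw [eq_sum_indicator_cell A (fun i => F i θ.2), Finset.sum_mul]
    refine Finset.sum_congr rfl fun i _ => ?_
    by_cases h : θ.1 ∈ cell A i <;> simp [indicator, h]
  simp only [hR]
  rw [integral_finsetSum _ fun i _ => hint i]
  refine Finset.sum_congr rfl fun i _ => ?_
  have hi := hint i
  rw [Measure.volume_eq_prod] at hi ⊢
  rw [integral_prod_symm _ hi, setIntegral_eq_integral_of_forall_compl_eq_zero]
  · refine integral_congr_ae (ae_of_all _ fun e => ?_)
    simp only [regionDensity]
    rw [← integral_const_mul, ← integral_indicator (measurableSet_cell hA i)]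
    rfl
  · intro e he
    have : ∀ x, p (x, e) = 0 := fun x => hp.eq_zero _ fun h => he h.2
    simp [regionDensity, this]

/-- Regrouping the cells gives back the response law, and the noise entropy is the same function of
`e` on every cell. -/
theorem mixtureGain_eq (hp : IsPriorDensity 𝒳 p) (hA : ∀ m, MeasurableSet (A m)) :
    mixtureGain p A = shannonEntropy (predictive p A) - M + meanCapacity p := by
  have h1 : ∀ y, ∑ i, ∫ e in epsBox M, bscProd e i y * regionDensity p (cell A i) e
      = predictive p A y := fun y =>
    hp.sum_integral_mul_regionDensity hA (F := fun i e => bscProd e i y) (c := 1)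
      (fun i => measurable_bscProd i y) fun i e he => by
        rw [abs_of_pos (bscProd_pos he i y)]
        exact bscProd_le_one he i y
  have h2 : ∑ i, ∫ e in epsBox M, shannonEntropy (bscProd e i) * regionDensity p (cell A i) e
      = M - meanCapacity p := by
    have h3 : ∀ i : Resp M,
        ∫ e in epsBox M, shannonEntropy (bscProd e i) * regionDensity p (cell A i) e
          = ∫ e in epsBox M, (M - ∑ m, bscCapacity (e m)) * regionDensity p (cell A i) e :=
      fun i => setIntegral_congr_fun (measurableSet_epsBox M) fun e he => by
        simp only [shannonEntropy_bscProd he]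
    have hsum : ∀ e ∈ epsBox M, |∑ m, bscCapacity (e m)| ≤ M := fun e he => by
      refine (Finset.abs_sum_le_sum_abs _ _).trans ?_
      refine (Finset.sum_le_sum fun m _ => abs_bscCapacity_le_one (he m)).trans ?_
      simp
    have hmeas : Measurable fun e : Fin M → ℝ => ∑ m, bscCapacity (e m) :=
      Finset.measurable_sum _ fun m _ => continuous_bscCapacity.measurable.comp
        (measurable_pi_apply m)
    rw [Finset.sum_congr rfl fun i _ => h3 i,
      hp.sum_integral_mul_regionDensity hA (F := fun _ e => M - ∑ m, bscCapacity (e m))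
        (c := M + M) (fun i => measurable_const.sub hmeas) fun i e he => by
          refine (abs_sub _ _).trans (add_le_add ?_ (hsum e he))
          simp]
    simp only [sub_mul]
    rw [integral_sub (hp.integrable.const_mul _) hp.integrable_sum_capacity_mul,
      integral_const_mul, hp.integral_eq_one, mul_one]
    rfl
  unfold mixtureGain
  rw [h2]
  simp only [h1]
  ring

theorem entropyLoss_eq_mixtureGain (hp : IsPriorDensity 𝒳 p) (hA : ∀ m, MeasurableSet (A m)) :
    entropyLoss p A = mixtureGain p A := by
  rw [hp.entropyLoss_eq hA, hp.mixtureGain_eq hA]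

end IsPriorDensity

open Filter Topology

/-! ### Equidistribution of fine strips -/

/-- Continuity of translation in `L¹`, read off from the continuous action of the translation group
on `Lp`. -/
theorem tendsto_integral_abs_vadd_sub {d : ℕ} {φ : (Fin d → ℝ) → ℝ} (hφ : Integrable φ) :
    Tendsto (fun v : Fin d → ℝ => ∫ x, |φ (v + x) - φ x|) (𝓝 0) (𝓝 0) := by
  have : Fact ((1 : ENNReal) ≠ ⊤) := ⟨ENNReal.one_ne_top⟩
  have hmem : MemLp φ 1 (volume : Measure (Fin d → ℝ)) := memLp_one_iff_integrable.2 hφ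
  set f : Lp ℝ 1 (volume : Measure (Fin d → ℝ)) := hmem.toLp φ with hf
  have hcont : Continuous fun v : Fin d → ℝ => ‖(DomAddAct.mk v +ᵥ f) - f‖ := by
    have : Continuous fun v : Fin d → ℝ => DomAddAct.mk v +ᵥ f :=
      (DomAddAct.continuous_mk).vadd continuous_const
    fun_prop
  have hval : ∀ v : Fin d → ℝ, ‖(DomAddAct.mk v +ᵥ f) - f‖ = ∫ x, |φ (v + x) - φ x| := by
    intro v
    rw [L1.norm_eq_integral_norm]
    refine integral_congr_ae ?_
    have h1 : (DomAddAct.mk v +ᵥ f : Lp ℝ 1 (volume : Measure (Fin d → ℝ)))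
        =ᵐ[volume] fun x => φ (v + x) := by
      rw [hf, DomAddAct.mk_vadd_toLp]
      exact MemLp.coeFn_toLp _
    filter_upwards [Lp.coeFn_sub (DomAddAct.mk v +ᵥ f) f, h1, hmem.coeFn_toLp] with x h2 h3 h4
    rw [h2, Pi.sub_apply, h3, hf, h4, Real.norm_eq_abs]
  have h0 := hcont.tendsto 0
  simp only [hval] at h0
  simpa using h0

/-- The union of the strips `j / K ≤ x_l < (j + 1) / K` with `j ≡ c` modulo `q`. -/
def strips {d : ℕ} (l : Fin d) (q K : ℕ) (c : ZMod q) : Set (Fin d → ℝ) :=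
  {x | ((⌊(K : ℝ) * x l⌋ : ℤ) : ZMod q) = c}

theorem mem_strips_iff {d : ℕ} {l : Fin d} {q K : ℕ} {c : ZMod q} {x : Fin d → ℝ} :
    x ∈ strips l q K c ↔ ((⌊(K : ℝ) * x l⌋ : ℤ) : ZMod q) = c :=
  Iff.rfl

theorem measurableSet_strips {d : ℕ} (l : Fin d) (q K : ℕ) (c : ZMod q) :
    MeasurableSet (strips l q K c) := by
  have h : Measurable fun x : Fin d → ℝ => ⌊(K : ℝ) * x l⌋ :=
    Int.measurable_floor.comp ((measurable_pi_apply l).const_mul _)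
  exact h (t := {j : ℤ | (j : ZMod q) = c}) trivial

theorem add_mem_strips_iff {d : ℕ} (l : Fin d) (q : ℕ) {K : ℕ} (hK : 0 < K) (c : ZMod q) (j : ℕ)
    (x : Fin d → ℝ) :
    Pi.single l ((j : ℝ) / K) + x ∈ strips l q K (c + j) ↔ x ∈ strips l q K c := by
  have hK' : (K : ℝ) ≠ 0 := by positivity
  have : (K : ℝ) * (((Pi.single l ((j : ℝ) / K) : Fin d → ℝ) + x) l) = K * x l + j := by
    simp only [Pi.add_apply, Pi.single_eq_same]
    field_simp
    ring
  rw [mem_strips_iff, mem_strips_iff, this, Int.floor_add_natCast]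
  push_cast
  exact add_left_inj _

/-- Translation by `j / K` carries one class onto the other, so the difference is at most the `L¹`
distance between `φ` and a translate by a vector tending to `0`. -/
theorem tendsto_setIntegral_strips_sub {d : ℕ} (l : Fin d) (q : ℕ) {φ : (Fin d → ℝ) → ℝ}
    (hφ : Integrable φ) (c : ZMod q) (j : ℕ) :
    Tendsto (fun K : ℕ => (∫ x in strips l q K (c + j), φ x) - ∫ x in strips l q K c, φ x)
      atTop (𝓝 0) := by
  have hv : Tendsto (fun K : ℕ => (Pi.single l ((j : ℝ) / K) : Fin d → ℝ)) atTop (𝓝 0) := by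
    have h1 : Tendsto (fun K : ℕ => (j : ℝ) / K) atTop (𝓝 0) :=
      tendsto_const_div_atTop_nhds_zero_nat _
    have h2 := ((continuous_single (A := fun _ : Fin d => ℝ) l).tendsto 0).comp h1
    simpa [Function.comp_def] using h2
  refine squeeze_zero_norm' ?_ ((tendsto_integral_abs_vadd_sub hφ).comp hv)
  filter_upwards [eventually_gt_atTop 0] with K hK
  set v : Fin d → ℝ := Pi.single l ((j : ℝ) / K) with hvdef
  have hφv : Integrable fun x => φ (v + x) := hφ.comp_add_left v
  have h1 : ∫ x in strips l q K (c + j), φ x = ∫ x in strips l q K c, φ (v + x) := by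
    rw [← integral_indicator (measurableSet_strips l q K _),
      ← integral_indicator (measurableSet_strips l q K _),
      ← integral_add_left_eq_self _ v]
    refine integral_congr_ae (ae_of_all _ fun x => ?_)
    have hiff := add_mem_strips_iff l q hK c j x
    rw [← hvdef] at hiff
    by_cases hx : x ∈ strips l q K c
    · simp only [indicator_of_mem hx, indicator_of_mem (hiff.2 hx)]
    · simp only [indicator_of_notMem hx, indicator_of_notMem (mt hiff.1 hx)]
  rw [h1, ← integral_sub hφv.integrableOn hφ.integrableOn]
  refine (norm_integral_le_integral_norm _).trans ?_
  exact setIntegral_le_integral (hφv.sub hφ).norm (ae_of_all _ fun x => norm_nonneg _)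

/-- Each residue class of strips carries in the limit its share of the integral. -/
theorem tendsto_setIntegral_strips {d : ℕ} (l : Fin d) (q : ℕ) [NeZero q] {φ : (Fin d → ℝ) → ℝ}
    (hφ : Integrable φ) (c : ZMod q) :
    Tendsto (fun K : ℕ => ∫ x in strips l q K c, φ x) atTop (𝓝 ((q : ℝ)⁻¹ * ∫ x, φ x)) := by
  have hq : (q : ℝ) ≠ 0 := NeZero.ne _
  -- The `q` residue classes partition the space; since their integrals become equal, each tends to
  -- one `q`-th of the total.
  have hsum : ∀ K : ℕ, ∑ j : ZMod q, ∫ x in strips l q K (c + (j.val : ℕ)), φ x = ∫ x, φ x := by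
    intro K
    simp only [ZMod.natCast_val, ZMod.cast_id', id_eq]
    change ∑ j : ZMod q, ∫ x in strips l q K (Equiv.addLeft c j), φ x = _
    rw [Equiv.sum_comp (Equiv.addLeft c) (fun c' => ∫ x in strips l q K c', φ x),
      ← integral_iUnion_fintype (fun c' => measurableSet_strips l q K c') ?_
      fun _ => hφ.integrableOn]
    · have : ⋃ c', strips l q K c' = univ := by
        ext x
        simp [strips]
      rw [this, setIntegral_univ]
    · intro c₁ c₂ hne
      rw [Function.onFun, Set.disjoint_left]
      rintro x (h1 : _ = _) (h2 : _ = _)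
      exact hne (h1.symm.trans h2)
  have hlim : Tendsto (fun K : ℕ => ∑ j : ZMod q,
      ((∫ x in strips l q K (c + (j.val : ℕ)), φ x) - ∫ x in strips l q K c, φ x))
      atTop (𝓝 (∑ _j : ZMod q, 0)) :=
    tendsto_finsetSum _ fun j _ => tendsto_setIntegral_strips_sub l q hφ c j.val
  simp only [Finset.sum_sub_distrib, hsum, Finset.sum_const, Finset.card_univ, ZMod.card,
    nsmul_eq_mul, mul_zero] at hlim
  have h2 := ((tendsto_const_nhds (x := ∫ x, φ x)).sub hlim).const_mul (q : ℝ)⁻¹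
  refine (h2.congr fun K => ?_).trans (by simp)
  field_simp
  ring

/-! ### Constructing query regions -/

namespace IsQueryRegion

variable {d : ℕ} {𝒳 : Set (Fin d → ℝ)}

theorem of_finite {ι : Type*} [Finite ι] (a b : ι → Fin d → ℝ) (hab : ∀ i l, a i l ≤ b i l)
    (h : ∀ i, rect (a i) (b i) ⊆ 𝒳) : IsQueryRegion 𝒳 (⋃ i, rect (a i) (b i)) := by
  obtain ⟨n, ⟨f⟩⟩ := Finite.exists_equiv_fin ι
  refine ⟨n, a ∘ f.symm, b ∘ f.symm, fun j => hab _, fun j => h _, ?_⟩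
  exact (f.symm.surjective.iUnion_comp fun i => rect (a i) (b i)).symm

theorem empty : IsQueryRegion 𝒳 ∅ :=
  ⟨0, Fin.elim0, Fin.elim0, fun j => j.elim0, fun j => j.elim0, by simp⟩

theorem iUnion {ι : Type*} [Finite ι] {A : ι → Set (Fin d → ℝ)}
    (h : ∀ i, IsQueryRegion 𝒳 (A i)) : IsQueryRegion 𝒳 (⋃ i, A i) := by
  choose J a b hab hsub hA using h
  have : ⋃ i, A i = ⋃ k : Σ i, Fin (J i), rect (a k.1 k.2) (b k.1 k.2) := by
    rw [iUnion_sigma]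
    exact iUnion_congr hA
  rw [this]
  exact of_finite _ _ (fun k => hab k.1 k.2) fun k => hsub k.1 k.2

theorem of_rect {a b : Fin d → ℝ} (h : rect a b ⊆ 𝒳) : IsQueryRegion 𝒳 (rect a b) := by
  by_cases hab : ∀ l, a l ≤ b l
  · have := of_finite (𝒳 := 𝒳) (fun _ : Unit => a) (fun _ => b) (fun _ => hab) fun _ => h
    rwa [iUnion_const] at this
  · have : rect a b = ∅ := by
      refine eq_empty_of_forall_notMem fun x hx => hab fun l => ?_
      exact (hx l).1.trans (hx l).2.le
    rw [this]
    exact empty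

/-- A rectangle meets finitely many strips, and each one only shortens its side in direction `l`. A
shortened side may have its endpoints reversed, in which case the rectangle is empty and `of_rect`
still applies. -/
theorem inter_strips {A : Set (Fin d → ℝ)} (h : IsQueryRegion 𝒳 A) (l : Fin d) (q : ℕ) {K : ℕ}
    (hK : 0 < K) (c : ZMod q) : IsQueryRegion 𝒳 (A ∩ strips l q K c) := by
  have hK' : (0 : ℝ) < K := by exact_mod_cast hK
  obtain ⟨J, a, b, -, hsub, rfl⟩ := h
  have : (⋃ j, rect (a j) (b j)) ∩ strips l q K c
      = ⋃ j, ⋃ k : {k : ℤ // k ∈ Icc ⌊(K : ℝ) * a j l⌋ ⌊(K : ℝ) * b j l⌋ ∧ (k : ZMod q) = c},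
          rect (Function.update (a j) l (max (a j l) (k / K)))
            (Function.update (b j) l (min (b j l) ((k + 1) / K))) := by
    rw [iUnion_inter]
    refine iUnion_congr fun j => ?_
    ext x
    have hmem : ∀ k : ℤ, x ∈ rect (Function.update (a j) l (max (a j l) (k / K)))
        (Function.update (b j) l (min (b j l) ((k + 1) / K)))
          ↔ x ∈ rect (a j) (b j) ∧ ⌊(K : ℝ) * x l⌋ = k := by
      intro k
      have hk : ⌊(K : ℝ) * x l⌋ = k ↔ (k : ℝ) / K ≤ x l ∧ x l < (k + 1) / K := by
        rw [Int.floor_eq_iff, div_le_iff₀ hK', lt_div_iff₀ hK', mul_comm]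
      rw [hk]
      constructor
      · intro hx
        have hl := hx l
        simp only [Function.update_self, max_le_iff, lt_min_iff] at hl
        refine ⟨fun l' => ?_, hl.1.2, hl.2.2⟩
        by_cases hll : l' = l
        · subst hll
          exact ⟨hl.1.1, hl.2.1⟩
        · have := hx l'
          rwa [Function.update_of_ne hll, Function.update_of_ne hll] at this
      · rintro ⟨hx, h1, h2⟩ l'
        by_cases hll : l' = l
        · subst hll
          simp only [Function.update_self, max_le_iff, lt_min_iff]
          exact ⟨⟨(hx _).1, h1⟩, (hx _).2, h2⟩
        · rw [Function.update_of_ne hll, Function.update_of_ne hll]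
          exact hx l'
    simp only [mem_iUnion, hmem, mem_inter_iff]
    constructor
    · rintro ⟨hx, hc⟩
      refine ⟨⟨⌊(K : ℝ) * x l⌋, ⟨?_, ?_⟩, hc⟩, hx, rfl⟩
      · exact Int.floor_le_floor (mul_le_mul_of_nonneg_left (hx l).1 hK'.le)
      · exact Int.floor_le_floor (mul_le_mul_of_nonneg_left (hx l).2.le hK'.le)
    · rintro ⟨⟨k, -, hc⟩, hx, rfl⟩
      exact ⟨hx, hc⟩
  rw [this]
  refine iUnion fun j => ?_
  have : Finite {k : ℤ // k ∈ Icc ⌊(K : ℝ) * a j l⌋ ⌊(K : ℝ) * b j l⌋ ∧ (k : ZMod q) = c} :=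
    ((Set.finite_Icc _ _).subset fun k hk => hk.1 : Set.Finite {k : ℤ | _ ∧ _}).to_subtype
  refine iUnion fun k => of_rect (Subset.trans (fun x hx => ?_) (hsub j))
  intro l'
  have := hx l'
  by_cases hll : l' = l
  · subst hll
    simp only [Function.update_self, max_le_iff, lt_min_iff] at this
    exact ⟨this.1.1, this.2.1⟩
  · rwa [Function.update_of_ne hll, Function.update_of_ne hll] at this

end IsQueryRegion

/-- Query regions exhaust the interior of the target domain. -/
theorem exists_monotone_queryRegion {d : ℕ} (hd : 0 < d) (𝒳 : Set (Fin d → ℝ)) :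
    ∃ R : ℕ → Set (Fin d → ℝ), Monotone R ∧ (∀ n, IsQueryRegion 𝒳 (R n)) ∧
      interior 𝒳 ⊆ ⋃ n, R n := by
  -- Rational corners leave countably many rectangles, which can be enumerated and accumulated.
  let ι : Type := {ab : (Fin d → ℚ) × (Fin d → ℚ) //
    rect (fun l => (ab.1 l : ℝ)) (fun l => (ab.2 l : ℝ)) ⊆ 𝒳}
  have : Nonempty ι := by
    refine ⟨⟨(0, 0), fun x hx => ?_⟩⟩
    -- The degenerate rectangle is empty because some coordinate exists; in dimension zero it would
    -- be the whole space.
    have := hx ⟨0, hd⟩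
    exact absurd this.2 (not_lt.2 this.1)
  obtain ⟨f, hf⟩ := exists_surjective_nat ι
  let s : ℕ → Set (Fin d → ℝ) := fun n =>
    rect (fun l => ((f n).1.1 l : ℝ)) fun l => ((f n).1.2 l : ℝ)
  refine ⟨Set.accumulate s, Set.monotone_accumulate, fun n => ?_, ?_⟩
  · have : Set.accumulate s n = ⋃ k : {k // k ∈ Iic n}, s k := by
      ext x
      simp [Set.accumulate]
    rw [this]
    have : Finite {k // k ∈ Iic n} := (Set.finite_Iic n).to_subtype
    exact IsQueryRegion.iUnion fun k => IsQueryRegion.of_rect (f k).2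
  · rw [Set.iUnion_accumulate]
    intro x hx
    obtain ⟨r, hr, hball⟩ := Metric.isOpen_iff.1 isOpen_interior x hx
    choose a ha1 ha2 using fun l => exists_rat_btwn (show x l - r < x l by linarith)
    choose b hb1 hb2 using fun l => exists_rat_btwn (show x l < x l + r by linarith)
    have hsub : rect (fun l => (a l : ℝ)) (fun l => (b l : ℝ)) ⊆ 𝒳 := by
      intro z hz
      refine interior_subset (hball ?_)
      rw [Metric.mem_ball, dist_pi_lt_iff hr]
      intro l
      rw [Real.dist_eq, abs_lt]
      constructor <;> linarith [(hz l).1, (hz l).2, ha1 l, hb2 l]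
    obtain ⟨n, hn⟩ := hf ⟨(a, b), hsub⟩
    refine mem_iUnion.2 ⟨n, ?_⟩
    simp only [s, hn]
    exact fun l => ⟨(ha2 l).le, hb1 l⟩

/-! ### The value of the maximal gain -/

/-- The density at `x` of the event that the target is `x` and the players, asked questions with
answers `i`, respond with `y`. -/
noncomputable def responseDensity {d M : ℕ} (p : Param d M → ℝ) (i y : Resp M)
    (x : Fin d → ℝ) : ℝ :=
  ∫ e, bscProd e i y * p (x, e)

/-- The query of player `m` asks for the `m`-th bit of the residue class of the strip of `x`. -/
def stripQuery {d M : ℕ} (R : Set (Fin d → ℝ)) (E : ZMod (2 ^ M) ≃ Resp M) (l : Fin d) (K : ℕ)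
    (m : Fin M) : Set (Fin d → ℝ) :=
  ⋃ c : {c : ZMod (2 ^ M) // E c m = true}, R ∩ strips l (2 ^ M) K c

theorem isQueryRegion_stripQuery {d M : ℕ} {𝒳 R : Set (Fin d → ℝ)} (hR : IsQueryRegion 𝒳 R)
    (E : ZMod (2 ^ M) ≃ Resp M) (l : Fin d) {K : ℕ} (hK : 0 < K) (m : Fin M) :
    IsQueryRegion 𝒳 (stripQuery R E l K m) :=
  IsQueryRegion.iUnion fun c => hR.inter_strips l _ hK c.1

theorem answers_stripQuery_of_mem {d M : ℕ} {R : Set (Fin d → ℝ)} (E : ZMod (2 ^ M) ≃ Resp M)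
    (l : Fin d) (K : ℕ) {x : Fin d → ℝ} (hx : x ∈ R) :
    answers (stripQuery R E l K) x = E (⌊(K : ℝ) * x l⌋ : ℤ) := by
  funext m
  rw [Bool.eq_iff_iff]
  simp [answers, stripQuery, hx, mem_strips_iff]

theorem answers_stripQuery_of_notMem {d M : ℕ} {R : Set (Fin d → ℝ)} (E : ZMod (2 ^ M) ≃ Resp M)
    (l : Fin d) (K : ℕ) {x : Fin d → ℝ} (hx : x ∉ R) :
    answers (stripQuery R E l K) x = fun _ => false := by
  funext m
  simp [answers, stripQuery, hx]

namespace IsPriorDensity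

variable {d M : ℕ} {𝒳 : Set (Fin d → ℝ)} {p : Param d M → ℝ} {A : Fin M → Set (Fin d → ℝ)}

theorem integrable_bscProd_mul (hp : IsPriorDensity 𝒳 p) (i y : Resp M) :
    Integrable fun θ : Param d M => bscProd θ.2 i y * p θ :=
  hp.integrable_mul (c := 1) ((measurable_bscProd i y).comp measurable_snd) fun θ hθ => by
    rw [abs_of_pos (bscProd_pos hθ i y)]
    exact bscProd_le_one hθ i y

theorem integrable_responseDensity (hp : IsPriorDensity 𝒳 p) (i y : Resp M) :
    Integrable (responseDensity p i y) := by
  have h := hp.integrable_bscProd_mul i y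
  rw [Measure.volume_eq_prod] at h
  exact h.integral_prod_left

theorem responseDensity_eq_zero (hp : IsPriorDensity 𝒳 p) (i y : Resp M) {x : Fin d → ℝ}
    (hx : x ∉ 𝒳) : responseDensity p i y x = 0 := by
  have : ∀ e, p (x, e) = 0 := fun e => hp.eq_zero _ fun h => hx h.1
  simp [responseDensity, this]

/-- The channel is symmetric, so for a fixed response the likelihoods sum to `1` over the inputs and
only the total mass of `p` remains. -/
theorem sum_integral_responseDensity (hp : IsPriorDensity 𝒳 p) (y : Resp M) :
    ∑ i, ∫ x, responseDensity p i y x = 1 := by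
  have h1 : ∀ i, ∫ x, responseDensity p i y x = ∫ θ : Param d M, bscProd θ.2 i y * p θ := by
    intro i
    have h := hp.integrable_bscProd_mul i y
    rw [Measure.volume_eq_prod] at h ⊢
    rw [integral_prod _ h]
    rfl
  simp only [h1]
  rw [← integral_finsetSum _ fun i _ => hp.integrable_bscProd_mul i y]
  simp only [← Finset.sum_mul, bscProd_comm _ _ y, sum_bscProd, one_mul]
  exact hp.integral_eq_one

theorem predictive_eq_integral_responseDensity (hp : IsPriorDensity 𝒳 p)
    (hA : ∀ m, MeasurableSet (A m)) (y : Resp M) :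
    predictive p A y = ∫ x, responseDensity p (answers A x) y x := by
  have h := hp.integrable_likelihood_mul hA y
  unfold predictive
  rw [Measure.volume_eq_prod] at h ⊢
  rw [integral_prod _ h]
  rfl

theorem integrable_responseDensity_answers (hp : IsPriorDensity 𝒳 p)
    (hA : ∀ m, MeasurableSet (A m)) (y : Resp M) :
    Integrable fun x => responseDensity p (answers A x) y x := by
  have h := hp.integrable_likelihood_mul hA y
  rw [Measure.volume_eq_prod] at h
  exact h.integral_prod_left

/-- Inside `R` the input is `i` exactly on the class `E.symm i`; outside `R` every answer is
`false`. This isolates integrals over strips of functions independent of `K`. -/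
theorem predictive_stripQuery (hp : IsPriorDensity 𝒳 p) {R : Set (Fin d → ℝ)}
    (hR : IsQueryRegion 𝒳 R) (E : ZMod (2 ^ M) ≃ Resp M) (l : Fin d) {K : ℕ} (hK : 0 < K)
    (y : Resp M) :
    predictive p (stripQuery R E l K) y
      = (∑ i, ∫ x in strips l (2 ^ M) K (E.symm i), R.indicator (responseDensity p i y) x)
        + ∫ x in Rᶜ, responseDensity p (fun _ => false) y x := by
  have hA : ∀ m, MeasurableSet (stripQuery R E l K m) := fun m =>
    (isQueryRegion_stripQuery hR E l hK m).measurableSet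
  have hi : ∀ i, Integrable (R.indicator (responseDensity p i y)) := fun i =>
    (hp.integrable_responseDensity i y).indicator hR.measurableSet
  rw [hp.predictive_eq_integral_responseDensity hA,
    ← integral_add_compl hR.measurableSet (hp.integrable_responseDensity_answers hA y)]
  congr 1
  · have h1 : ∀ i, ∫ x in strips l (2 ^ M) K (E.symm i), R.indicator (responseDensity p i y) x
        = ∫ x, (strips l (2 ^ M) K (E.symm i)).indicator (R.indicator (responseDensity p i y)) x :=
      fun i => (integral_indicator (measurableSet_strips l _ K _)).symm
    simp only [h1]
    rw [← integral_finsetSum _ fun i _ => (hi i).indicator (measurableSet_strips l _ K _),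
      ← integral_indicator hR.measurableSet]
    refine integral_congr_ae (ae_of_all _ fun x => ?_)
    by_cases hx : x ∈ R
    · simp only [indicator_of_mem hx, answers_stripQuery_of_mem E l K hx]
      rw [Finset.sum_eq_single (E (⌊(K : ℝ) * x l⌋ : ℤ))]
      · rw [indicator_of_mem, indicator_of_mem hx]
        simp [mem_strips_iff]
      · intro i _ hne
        rw [indicator_of_notMem]
        rw [mem_strips_iff, Equiv.eq_symm_apply]
        exact hne.symm
      · simp
    · simp [indicator, hx]
  · refine setIntegral_congr_fun hR.measurableSet.compl fun x hx => ?_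
    simp only [answers_stripQuery_of_notMem E l K hx]

/-- With queries of fine enough strips, the responses are almost uniformly distributed. -/
theorem exists_entropyLoss_gt (hp : IsPriorDensity 𝒳 p) (hd : 0 < d)
    (h𝒳 : volume (frontier 𝒳) = 0) {b : ℝ} (hb : b < meanCapacity p) :
    ∃ A : JointQuery 𝒳 M, b < entropyLoss p A.regions := by
  obtain ⟨R, hmono, hR, hcov⟩ := exists_monotone_queryRegion hd 𝒳
  let l : Fin d := ⟨0, hd⟩
  let E : ZMod (2 ^ M) ≃ Resp M := Fintype.equivOfCardEq (by simp [ZMod.card])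
  -- The limiting response law as `K → ∞` with the region `R n` fixed: uniform input inside,
  -- constant input outside.
  let u : ℕ → Resp M → ℝ := fun n y =>
    (∑ i, ((2 ^ M : ℕ) : ℝ)⁻¹ * ∫ x, (R n).indicator (responseDensity p i y) x)
      + ∫ x in (R n)ᶜ, responseDensity p (fun _ => false) y x
  have hK : ∀ n, Tendsto (fun K : ℕ => shannonEntropy (predictive p (stripQuery (R n) E l K)))
      atTop (𝓝 (shannonEntropy (u n))) := by
    intro n
    refine (continuous_shannonEntropy.tendsto _).comp (tendsto_pi_nhds.2 fun y => ?_)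
    have h1 : Tendsto (fun K : ℕ =>
        (∑ i, ∫ x in strips l (2 ^ M) K (E.symm i), (R n).indicator (responseDensity p i y) x)
          + ∫ x in (R n)ᶜ, responseDensity p (fun _ => false) y x) atTop (𝓝 (u n y)) :=
      (tendsto_finsetSum _ fun i _ => tendsto_setIntegral_strips l (2 ^ M)
        ((hp.integrable_responseDensity i y).indicator (hR n).measurableSet) _).add_const _
    refine h1.congr' ?_
    filter_upwards [eventually_gt_atTop 0] with K hK
    exact (hp.predictive_stripQuery (hR n) E l hK y).symm
  have hset : ∀ i y, Tendsto (fun n => ∫ x in R n, responseDensity p i y x) atTop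
      (𝓝 (∫ x, responseDensity p i y x)) := by
    intro i y
    have h1 := tendsto_setIntegral_of_monotone (μ := volume) (fun n => (hR n).measurableSet) hmono
      (hp.integrable_responseDensity i y).integrableOn
    have h2 : ∫ x in ⋃ n, R n, responseDensity p i y x = ∫ x, responseDensity p i y x := by
      refine setIntegral_eq_integral_of_ae_compl_eq_zero ?_
      have hnull : ∀ᵐ x : Fin d → ℝ, x ∉ frontier 𝒳 := measure_eq_zero_iff_ae_notMem.1 h𝒳
      filter_upwards [hnull] with x hx hxR
      -- A point missed by all the regions is not interior; off the null frontier it lies outside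
      -- `𝒳`, where the density vanishes.
      refine hp.responseDensity_eq_zero i y fun hx𝒳 => hx ⟨subset_closure hx𝒳, fun hint => ?_⟩
      exact hxR (hcov hint)
    rwa [h2] at h1
  have hu : Tendsto (fun n => shannonEntropy (u n)) atTop (𝓝 (M : ℝ)) := by
    rw [← shannonEntropy_uniform M]
    refine (continuous_shannonEntropy.tendsto _).comp (tendsto_pi_nhds.2 fun y => ?_)
    have h1 : Tendsto (fun n => ∫ x in (R n)ᶜ, responseDensity p (fun _ => false) y x) atTop
        (𝓝 0) := by
      have h2 := (tendsto_const_nhds (x := ∫ x, responseDensity p (fun _ => false) y x)).sub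
        (hset (fun _ => false) y)
      rw [sub_self] at h2
      refine h2.congr fun n => ?_
      rw [sub_eq_iff_eq_add']
      exact (integral_add_compl (hR n).measurableSet (hp.integrable_responseDensity _ y)).symm
    have h3 := (tendsto_finsetSum Finset.univ
      fun i _ => (hset i y).const_mul ((2 ^ M : ℕ) : ℝ)⁻¹).add h1
    rw [← Finset.mul_sum, hp.sum_integral_responseDensity] at h3
    simp only [mul_one, add_zero, Nat.cast_pow, Nat.cast_ofNat] at h3
    refine h3.congr fun n => ?_
    simp only [u, integral_indicator (hR n).measurableSet, Nat.cast_pow, Nat.cast_ofNat]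
  -- By `entropyLoss_eq`, the loss exceeds `b` once the response entropy exceeds `b + M -
  -- meanCapacity p`. First `n` is fixed, then `K`.
  have hlt : b + M - meanCapacity p < M := by linarith
  obtain ⟨n, hn⟩ := (hu.eventually_const_lt hlt).exists
  obtain ⟨K, hKb, hK0⟩ := (((hK n).eventually_const_lt hn).and (eventually_gt_atTop 0)).exists
  let A : JointQuery 𝒳 M := fun m => ⟨stripQuery (R n) E l K m,
    isQueryRegion_stripQuery (hR n) E l hK0 m⟩
  refine ⟨A, ?_⟩
  rw [hp.entropyLoss_eq A.measurableSet_regions]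
  have : A.regions = stripQuery (R n) E l K := rfl
  rw [this]
  linarith

theorem isLUB_entropyLoss (hp : IsPriorDensity 𝒳 p) (hd : 0 < d) (h𝒳 : volume (frontier 𝒳) = 0) :
    IsLUB (range fun A : JointQuery 𝒳 M => entropyLoss p A.regions) (meanCapacity p) := by
  refine ⟨?_, fun b hb => ?_⟩
  · rintro _ ⟨A, rfl⟩
    exact hp.entropyLoss_le_meanCapacity A.measurableSet_regions
  · by_contra! h
    obtain ⟨A, hA⟩ := hp.exists_entropyLoss_gt hd h𝒳 h
    exact hA.not_ge (hb ⟨A, rfl⟩)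

theorem maxGain_eq (hp : IsPriorDensity 𝒳 p) (hd : 0 < d) (h𝒳 : volume (frontier 𝒳) = 0) :
    maxGain 𝒳 p = meanCapacity p := by
  have : Nonempty (JointQuery 𝒳 M) := ⟨fun _ => ⟨∅, IsQueryRegion.empty⟩⟩
  exact (hp.isLUB_entropyLoss hd h𝒳).ciSup_eq

end IsPriorDensity

/-! ### Marginal densities of the crossover probabilities -/

/-- The vector with `m`-th coordinate `t` and the other coordinates given by `η`. -/
def insertCoord {M : ℕ} (m : Fin M) (t : ℝ) (η : {k : Fin M // k ≠ m} → ℝ) : Fin M → ℝ :=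
  fun k => if hk : k = m then t else η ⟨k, hk⟩

theorem measurePreserving_insertCoord {M : ℕ} (m : Fin M) :
    MeasurePreserving (fun z : ℝ × ({k : Fin M // k ≠ m} → ℝ) => insertCoord m z.1 z.2) := by
  have h1 : MeasurePreserving
      (MeasurableEquiv.piEquivPiSubtypeProd (fun _ : Fin M => ℝ) (fun k => k = m)).symm
      ((volume : Measure ({k : Fin M // k = m} → ℝ)).prod
        (volume : Measure ({k : Fin M // ¬ k = m} → ℝ))) volume := by
    convert (volume_preserving_piEquivPiSubtypeProd (fun _ : Fin M => ℝ) (fun k => k = m)).symm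
    · rfl
    · rw [Measure.volume_eq_prod]
      congr!
  have h2 : MeasurePreserving (MeasurableEquiv.funUnique {k : Fin M // k = m} ℝ).symm
      (volume : Measure ℝ) (volume : Measure ({k : Fin M // k = m} → ℝ)) := by
    convert (volume_preserving_funUnique {k : Fin M // k = m} ℝ).symm
  have h3 := h2.prod (MeasurePreserving.id (volume : Measure ({k : Fin M // ¬ k = m} → ℝ)))
  exact h1.comp h3

theorem measurePreserving_insertCoord_prod {d M : ℕ} (m : Fin M) :
    MeasurePreserving (fun z : ℝ × ((Fin d → ℝ) × ({k : Fin M // k ≠ m} → ℝ)) =>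
      ((z.2.1, insertCoord m z.1 z.2.2) : Param d M)) := by
  have h1 : MeasurePreserving (fun z : ℝ × ((Fin d → ℝ) × ({k : Fin M // k ≠ m} → ℝ)) =>
      (z.2.1, (z.1, z.2.2))) := by
    have ha := (measurePreserving_prodAssoc (volume : Measure ℝ) (volume : Measure (Fin d → ℝ))
      (volume : Measure ({k : Fin M // k ≠ m} → ℝ))).symm
    have hb := (Measure.measurePreserving_swap (μ := (volume : Measure ℝ))
      (ν := (volume : Measure (Fin d → ℝ)))).prod
        (MeasurePreserving.id (volume : Measure ({k : Fin M // k ≠ m} → ℝ)))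
    have hc := measurePreserving_prodAssoc (volume : Measure (Fin d → ℝ)) (volume : Measure ℝ)
      (volume : Measure ({k : Fin M // k ≠ m} → ℝ))
    exact (hc.comp hb).comp ha
  have h2 := (MeasurePreserving.id (volume : Measure (Fin d → ℝ))).prod
    (measurePreserving_insertCoord m)
  exact h2.comp h1

theorem IsPriorDensity.integral_mul_epsMarginal {d M : ℕ} {𝒳 : Set (Fin d → ℝ)}
    {p : Param d M → ℝ} (hp : IsPriorDensity 𝒳 p) (m : Fin M) :
    ∫ t in Ioo (0 : ℝ) (1 / 2), bscCapacity t * epsMarginal p m t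
      = ∫ θ, bscCapacity (θ.2 m) * p θ := by
  have hmp := measurePreserving_insertCoord_prod (d := d) m
  have hint : Integrable fun z : ℝ × ((Fin d → ℝ) × ({k : Fin M // k ≠ m} → ℝ)) =>
      p (z.2.1, insertCoord m z.1 z.2.2) :=
    hmp.integrable_comp_of_integrable hp.integrable
  have hintC : Integrable fun z : ℝ × ((Fin d → ℝ) × ({k : Fin M // k ≠ m} → ℝ)) =>
      bscCapacity z.1 * p (z.2.1, insertCoord m z.1 z.2.2) := by
    refine (hmp.integrable_comp_of_integrable (hp.integrable_capacity_mul m)).congr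
      (ae_of_all _ fun z => ?_)
    simp [insertCoord]
  have hcomp : ∫ θ, bscCapacity (θ.2 m) * p θ
      = ∫ z : ℝ × ((Fin d → ℝ) × ({k : Fin M // k ≠ m} → ℝ)),
        bscCapacity z.1 * p (z.2.1, insertCoord m z.1 z.2.2) := by
    rw [← hmp.map_eq, integral_map hmp.measurable.aemeasurable]
    · simp [insertCoord]
    · rw [hmp.map_eq]
      exact (hp.integrable_capacity_mul m).aestronglyMeasurable
  rw [hcomp, setIntegral_eq_integral_of_forall_compl_eq_zero]
  · rw [Measure.volume_eq_prod] at hint hintC ⊢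
    rw [integral_prod _ hintC]
    refine integral_congr_ae ?_
    -- The marginal is an iterated integral; it agrees with the integral over the slice only where
    -- the slice is integrable, which holds for almost every `t`.
    filter_upwards [hint.prod_right_ae] with t ht
    rw [integral_const_mul]
    rw [Measure.volume_eq_prod] at ht ⊢
    rw [integral_prod _ ht]
    rfl
  · intro t ht
    have : ∀ x η, p (x, insertCoord m t η) = 0 := fun x η => hp.eq_zero _ fun h => ht <| by
      have := h.2 m
      simpa [insertCoord] using this
    unfold insertCoord at this
    simp [epsMarginal, this]

/-! ### The posterior densities -/

theorem IsPriorDensity.jointPosterior {d M : ℕ} {𝒳 : Set (Fin d → ℝ)} {p₀ : Param d M → ℝ}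
    (hp₀ : IsPriorDensity 𝒳 p₀) (ζ : Policy 𝒳 M) :
    ∀ (n : ℕ) (h : Fin n → Resp M), IsPriorDensity 𝒳 (jointPosterior p₀ ζ n h)
  | 0, _ => hp₀
  | n + 1, h => (hp₀.jointPosterior ζ n (Fin.init h)).bayesUpdate
      (JointQuery.measurableSet_regions _) _

theorem jointPosterior_snoc {d M : ℕ} {𝒳 : Set (Fin d → ℝ)} (p₀ : Param d M → ℝ)
    (ζ : Policy 𝒳 M) (n : ℕ) (h : Fin n → Resp M) (y : Resp M) :
    jointPosterior p₀ ζ (n + 1) (Fin.snoc h y : Fin (n + 1) → Resp M)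
      = bayesUpdate (jointPosterior p₀ ζ n h) (ζ n h).regions y := by
  rw [jointPosterior, Fin.init_snoc, Fin.snoc_last]

theorem history_succ_eq_iff {M : ℕ} {Ω : Type*} {Y : ℕ → Ω → Resp M} (n : ℕ)
    (h : Fin (n + 1) → Resp M) (ω : Ω) :
    history Y (n + 1) ω = h ↔ history Y n ω = Fin.init h ∧ Y (n + 1) ω = h (Fin.last n) := by
  constructor
  · rintro rfl
    exact ⟨rfl, rfl⟩
  · rintro ⟨h1, h2⟩
    funext k
    refine Fin.lastCases ?_ (fun k => ?_) k
    · exact h2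
    · exact congrFun h1 k

/-! ### Conditional laws given the responses -/

section ObservedProcess

variable {d M : ℕ} {𝒳 : Set (Fin d → ℝ)} {Ω : Type*} [MeasurableSpace Ω] {μ : Measure Ω}

/-- The hypothesis on preimages identifies the law of `θ` restricted to `H` as `μ H` times the
measure with density `p`. -/
theorem IsPriorDensity.setIntegral_comp [IsFiniteMeasure μ] {p : Param d M → ℝ}
    (hp : IsPriorDensity 𝒳 p) {θ : Ω → Param d M} (hθ : Measurable θ) {H : Set Ω}
    (hB : ∀ B, MeasurableSet B → μ.real (θ ⁻¹' B ∩ H) = μ.real H * ∫ z in B, p z)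
    {F : Param d M → ℝ} (hF : Measurable F) :
    ∫ ω in H, F (θ ω) ∂μ = μ.real H * ∫ z, F z * p z := by
  have hmap : (μ.restrict H).map θ
      = μ H • volume.withDensity (fun z => ENNReal.ofReal (p z)) := by
    ext B hBm
    rw [Measure.map_apply hθ hBm, Measure.restrict_apply (hθ hBm), Measure.smul_apply,
      withDensity_apply _ hBm, smul_eq_mul,
      ← ofReal_integral_eq_lintegral_ofReal hp.integrable.integrableOn (ae_of_all _ hp.nonneg),
      ← ofReal_measureReal, ← ofReal_measureReal (s := H), hB B hBm,
      ENNReal.ofReal_mul measureReal_nonneg]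
  rw [← integral_map hθ.aemeasurable hF.aestronglyMeasurable, hmap, integral_smul_measure,
    integral_withDensity_eq_integral_toReal_smul hp.measurable.ennreal_ofReal
      (ae_of_all _ fun _ => ENNReal.ofReal_lt_top)]
  simp only [ENNReal.toReal_ofReal (hp.nonneg _), smul_eq_mul, mul_comm (F _)]
  rfl

variable {Y : ℕ → Ω → Resp M}

theorem measurable_history (hY : ∀ n, Measurable (Y n)) (n : ℕ) : Measurable (history Y n) :=
  measurable_pi_iff.2 fun _ => hY _

theorem measurableSet_history_eq (hY : ∀ n, Measurable (Y n)) (n : ℕ) (h : Fin n → Resp M) :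
    MeasurableSet {ω | history Y n ω = h} :=
  measurable_history hY n (measurableSet_singleton h)

theorem integrable_comp_history (hY : ∀ n, Measurable (Y n)) [IsFiniteMeasure μ] (n : ℕ)
    (φ : (Fin n → Resp M) → ℝ) : Integrable (fun ω => φ (history Y n ω)) μ :=
  (Integrable.of_finite (μ := μ.map (history Y n)) (f := φ)).comp_measurable
    (measurable_history hY n)

theorem setIntegral_comp_history (hY : ∀ n, Measurable (Y n)) (n : ℕ)
    (φ : (Fin n → Resp M) → ℝ) (h : Fin n → Resp M) :
    ∫ ω in {ω | history Y n ω = h}, φ (history Y n ω) ∂μ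
      = μ.real {ω | history Y n ω = h} * φ h := by
  rw [setIntegral_congr_fun (g := fun _ => φ h) (measurableSet_history_eq hY n h)
    fun ω (hω : history Y n ω = h) => by simp only [hω], setIntegral_const, smul_eq_mul]

theorem setIntegral_preimage_history (hY : ∀ n, Measurable (Y n)) (n : ℕ)
    (T : Set (Fin n → Resp M)) {f : Ω → ℝ} (hf : Integrable f μ) :
    ∫ ω in history Y n ⁻¹' T, f ω ∂μ
      = ∑ h ∈ T.toFinite.toFinset, ∫ ω in {ω | history Y n ω = h}, f ω ∂μ := by
  rw [← integral_biUnion_finset _ (fun h _ => measurableSet_history_eq hY n h) ?_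
    fun _ _ => hf.integrableOn]
  · congr 2
    ext ω
    simp
  · intro h₁ _ h₂ _ hne
    rw [Function.onFun, Set.disjoint_left]
    exact fun ω e₁ e₂ => hne (Eq.trans (Eq.symm e₁) e₂)

/-- A conditional expectation given the responses is determined by its values on the finitely many
histories. -/
theorem condExp_obs_eq (hY : ∀ n, Measurable (Y n)) [IsFiniteMeasure μ] (n : ℕ) {f : Ω → ℝ}
    (hf : Integrable f μ) (g : (Fin n → Resp M) → ℝ)
    (hg : ∀ h, ∫ ω in {ω | history Y n ω = h}, f ω ∂μ = μ.real {ω | history Y n ω = h} * g h) :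
    μ[f | obs Y n] =ᵐ[μ] fun ω => g (history Y n ω) := by
  have hint := integrable_comp_history (μ := μ) hY n g
  refine (ae_eq_condExp_of_forall_setIntegral_eq (measurable_history hY n).comap_le hf
    (fun s _ _ => hint.integrableOn) ?_ ?_).symm
  · rintro _ ⟨T, -, rfl⟩ -
    rw [setIntegral_preimage_history hY n T hint, setIntegral_preimage_history hY n T hf]
    exact Finset.sum_congr rfl fun h _ => by rw [hg, setIntegral_comp_history hY]
  · have h1 : Measurable[obs Y n] fun ω => g (history Y n ω) :=
      (measurable_of_finite g).comp (comap_measurable (history Y n))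
    exact h1.stronglyMeasurable.aestronglyMeasurable

namespace IsPolicyLaw

variable {p₀ : Param d M → ℝ} {X : Ω → Fin d → ℝ} {eps : Ω → Fin M → ℝ} {ζ : Policy 𝒳 M}

theorem integral_comp (hμ : IsPolicyLaw p₀ X eps Y ζ μ) (hp₀ : IsPriorDensity 𝒳 p₀)
    (hX : Measurable X) (heps : Measurable eps) {F : Param d M → ℝ} (hF : Measurable F) :
    ∫ ω, F (X ω, eps ω) ∂μ = ∫ z, F z * p₀ z := by
  rw [← integral_map (φ := fun ω => (X ω, eps ω)) (hX.prodMk heps).aemeasurable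
      hF.aestronglyMeasurable, hμ.prior,
    integral_withDensity_eq_integral_toReal_smul hp₀.measurable.ennreal_ofReal
      (ae_of_all _ fun _ => ENNReal.ofReal_lt_top)]
  simp only [ENNReal.toReal_ofReal (hp₀.nonneg _), smul_eq_mul, mul_comm (F _)]

theorem integrable_comp (hμ : IsPolicyLaw p₀ X eps Y ζ μ) (hp₀ : IsPriorDensity 𝒳 p₀)
    (hX : Measurable X) (heps : Measurable eps) {F : Param d M → ℝ}
    (hint : Integrable fun z => F z * p₀ z) :
    Integrable (fun ω => F (X ω, eps ω)) μ := by
  refine Integrable.comp_measurable (f := fun ω => (X ω, eps ω)) (g := F) ?_ (hX.prodMk heps)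
  rw [hμ.prior, integrable_withDensity_iff_integrable_smul' hp₀.measurable.ennreal_ofReal
    (ae_of_all _ fun _ => ENNReal.ofReal_lt_top)]
  simpa only [ENNReal.toReal_ofReal (hp₀.nonneg _), smul_eq_mul, mul_comm (p₀ _)] using hint

/-- One step of Bayes' rule for the law of the target and the responses. -/
theorem real_history_succ (hμ : IsPolicyLaw p₀ X eps Y ζ μ) (hp₀ : IsPriorDensity 𝒳 p₀)
    (hX : Measurable X) (heps : Measurable eps) (hY : ∀ n, Measurable (Y n)) (n : ℕ)
    (h : Fin (n + 1) → Resp M)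
    (ih : ∀ B, MeasurableSet B →
      μ.real ((fun ω => (X ω, eps ω)) ⁻¹' B ∩ {ω | history Y n ω = Fin.init h})
        = μ.real {ω | history Y n ω = Fin.init h}
          * ∫ z in B, jointPosterior p₀ ζ n (Fin.init h) z)
    {B : Set (Param d M)} (hB : MeasurableSet B) :
    μ.real ((fun ω => (X ω, eps ω)) ⁻¹' B ∩ {ω | history Y (n + 1) ω = h})
      = μ.real {ω | history Y n ω = Fin.init h}
        * (predictive (jointPosterior p₀ ζ n (Fin.init h)) (ζ n (Fin.init h)).regions
            (h (Fin.last n))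
          * ∫ z in B, jointPosterior p₀ ζ (n + 1) h z) := by
  have := hμ.isProbabilityMeasure
  set θ : Ω → Param d M := fun ω => (X ω, eps ω) with hθdef
  have hθ : Measurable θ := hX.prodMk heps
  set H : Set Ω := {ω | history Y n ω = Fin.init h} with hH
  set y := h (Fin.last n) with hy
  set A := (ζ n (Fin.init h)).regions with hAdef
  have hA : ∀ m, MeasurableSet (A m) := JointQuery.measurableSet_regions _
  have hp := hp₀.jointPosterior ζ n (Fin.init h)
  have hHm : MeasurableSet H := measurableSet_history_eq hY n _
  have hYm : MeasurableSet {ω | Y (n + 1) ω = y} := hY _ (measurableSet_singleton y)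
  have hle : MeasurableSpace.comap θ inferInstance ⊔ obs Y n ≤ ‹MeasurableSpace Ω› :=
    sup_le hθ.comap_le (measurable_history hY n).comap_le
  have hs : MeasurableSet[MeasurableSpace.comap θ inferInstance ⊔ obs Y n] (θ ⁻¹' B ∩ H) := by
    refine MeasurableSet.inter ?_ ?_
    · exact (le_sup_left : _ ≤ MeasurableSpace.comap θ inferInstance ⊔ obs Y n) _ ⟨B, hB, rfl⟩
    · exact (le_sup_right : _ ≤ MeasurableSpace.comap θ inferInstance ⊔ obs Y n) _
        ⟨{Fin.init h}, measurableSet_singleton _, rfl⟩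
  have hind : Integrable ({ω | Y (n + 1) ω = y}.indicator fun _ => (1 : ℝ)) μ :=
    (integrable_const 1).indicator hYm
  have h1 : μ.real (θ ⁻¹' B ∩ {ω | history Y (n + 1) ω = h})
      = ∫ ω in θ ⁻¹' B ∩ H, ({ω | Y (n + 1) ω = y}.indicator fun _ => (1 : ℝ)) ω ∂μ := by
    rw [integral_indicator_const _ hYm, smul_eq_mul, mul_one, measureReal_restrict_apply hYm]
    congr 1
    ext ω
    simp only [mem_inter_iff, mem_ofPred_eq, history_succ_eq_iff, H, y]
    tauto
  -- The event is known to the conditioning σ-algebra, so the indicator may be replaced by its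
  -- conditional expectation; on `H` the history, and hence the query, is fixed.
  have h2 : ∫ ω in θ ⁻¹' B ∩ H, ({ω | Y (n + 1) ω = y}.indicator fun _ => (1 : ℝ)) ω ∂μ
      = ∫ ω in θ ⁻¹' B ∩ H, likelihood A y (θ ω) ∂μ := by
    rw [← setIntegral_condExp hle hind hs,
      setIntegral_congr_ae (hle _ hs) ((hμ.response n y).mono fun ω hω _ => hω)]
    refine setIntegral_congr_fun (hle _ hs) fun ω hω => ?_
    have : history Y n ω = Fin.init h := hω.2
    simp only [this, hAdef, hθdef]
  have h3 : ∫ ω in θ ⁻¹' B ∩ H, likelihood A y (θ ω) ∂μ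
      = ∫ ω in H, B.indicator (likelihood A y) (θ ω) ∂μ := by
    rw [inter_comm, ← setIntegral_indicator (hθ hB)]
    rfl
  rw [h1, h2, h3, hp.setIntegral_comp hθ ih ((measurable_likelihood hA y).indicator hB)]
  congr 1
  have h4 : ∀ z, B.indicator (likelihood A y) z * jointPosterior p₀ ζ n (Fin.init h) z
      = B.indicator (fun z => predictive (jointPosterior p₀ ζ n (Fin.init h)) A y
          * jointPosterior p₀ ζ (n + 1) h z) z := by
    intro z
    by_cases hz : z ∈ B
    · simp only [indicator_of_mem hz, jointPosterior, bayesUpdate]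
      rw [mul_div_cancel₀ _ (hp.predictive_pos hA y).ne']
    · simp [indicator_of_notMem hz]
  simp only [h4]
  rw [integral_indicator hB, integral_const_mul]

/-- The joint law of the parameters and of the first `n` responses. -/
theorem real_inter_history (hμ : IsPolicyLaw p₀ X eps Y ζ μ) (hp₀ : IsPriorDensity 𝒳 p₀)
    (hX : Measurable X) (heps : Measurable eps) (hY : ∀ n, Measurable (Y n)) (n : ℕ)
    (h : Fin n → Resp M) (B : Set (Param d M)) (hB : MeasurableSet B) :
    μ.real ((fun ω => (X ω, eps ω)) ⁻¹' B ∩ {ω | history Y n ω = h})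
      = μ.real {ω | history Y n ω = h} * ∫ z in B, jointPosterior p₀ ζ n h z := by
  have := hμ.isProbabilityMeasure
  induction n generalizing B with
  | zero =>
    have h1 : {ω | history Y 0 ω = h} = univ := eq_univ_of_forall fun ω => Subsingleton.elim _ _
    have h2 := hμ.integral_comp hp₀ hX heps (F := B.indicator fun _ => 1)
      (measurable_const.indicator hB)
    have h3 : ∀ z, B.indicator (fun _ => (1 : ℝ)) z * p₀ z = B.indicator p₀ z := fun z => by
      by_cases hz : z ∈ B <;> simp [hz]
    simp only [h3] at h2
    rw [integral_indicator hB] at h2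
    rw [h1, inter_univ, probReal_univ, one_mul]
    change _ = ∫ z in B, p₀ z
    rw [← h2]
    have h4 : (fun ω => B.indicator (fun _ => (1 : ℝ)) (X ω, eps ω))
        = ((fun ω => (X ω, eps ω)) ⁻¹' B).indicator fun _ => 1 := rfl
    rw [h4, integral_indicator_const _ ((hX.prodMk heps) hB), smul_eq_mul, mul_one]
  | succ n ih =>
    have ih' := fun B hB => ih (Fin.init h) B hB
    have hstep := hμ.real_history_succ hp₀ hX heps hY n h ih' hB
    -- Taking `B` to be everything gives the probability of the longer history, which absorbs the
    -- factor `predictive`.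
    have huniv := hμ.real_history_succ hp₀ hX heps hY n h ih' MeasurableSet.univ
    rw [setIntegral_univ, (hp₀.jointPosterior ζ (n + 1) h).integral_eq_one, preimage_univ,
      univ_inter, mul_one] at huniv
    rw [hstep, huniv]
    ring

theorem real_history_snoc (hμ : IsPolicyLaw p₀ X eps Y ζ μ) (hp₀ : IsPriorDensity 𝒳 p₀)
    (hX : Measurable X) (heps : Measurable eps) (hY : ∀ n, Measurable (Y n)) (n : ℕ)
    (h : Fin n → Resp M) (y : Resp M) :
    μ.real {ω | history Y (n + 1) ω = (Fin.snoc h y : Fin (n + 1) → Resp M)}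
      = μ.real {ω | history Y n ω = h}
        * predictive (jointPosterior p₀ ζ n h) (ζ n h).regions y := by
  have huniv := hμ.real_history_succ hp₀ hX heps hY n (Fin.snoc h y : Fin (n + 1) → Resp M)
    (fun B hB => hμ.real_inter_history hp₀ hX heps hY n _ B hB) MeasurableSet.univ
  rwa [setIntegral_univ, (hp₀.jointPosterior ζ (n + 1) _).integral_eq_one, preimage_univ,
      univ_inter, mul_one, Fin.init_snoc, Fin.snoc_last] at huniv

/-- Conditional expectations of functions of the parameters are integrals against `pₙ`. -/
theorem condExp_comp (hμ : IsPolicyLaw p₀ X eps Y ζ μ) (hp₀ : IsPriorDensity 𝒳 p₀)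
    (hX : Measurable X) (heps : Measurable eps) (hY : ∀ n, Measurable (Y n)) (n : ℕ)
    {F : Param d M → ℝ} (hF : Measurable F) (hint : Integrable fun z => F z * p₀ z) :
    μ[fun ω => F (X ω, eps ω) | obs Y n]
      =ᵐ[μ] fun ω => ∫ z, F z * jointPosterior p₀ ζ n (history Y n ω) z := by
  have := hμ.isProbabilityMeasure
  refine condExp_obs_eq hY n (hμ.integrable_comp hp₀ hX heps hint)
    (fun h => ∫ z, F z * jointPosterior p₀ ζ n h z) fun h => ?_
  exact (hp₀.jointPosterior ζ n h).setIntegral_comp (hX.prodMk heps)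
    (fun B hB => hμ.real_inter_history hp₀ hX heps hY n h B hB) hF

theorem condExp_indicator (hμ : IsPolicyLaw p₀ X eps Y ζ μ) (hp₀ : IsPriorDensity 𝒳 p₀)
    (hX : Measurable X) (heps : Measurable eps) (hY : ∀ n, Measurable (Y n)) (n : ℕ)
    {B : Set (Param d M)} (hB : MeasurableSet B) :
    μ[({ω | (X ω, eps ω) ∈ B}).indicator (fun _ => (1 : ℝ)) | obs Y n]
      =ᵐ[μ] fun ω => ∫ z in B, jointPosterior p₀ ζ n (history Y n ω) z := by
  have hmul : ∀ (q : Param d M → ℝ) z, B.indicator (fun _ => (1 : ℝ)) z * q z = B.indicator q z :=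
    fun q z => by by_cases hz : z ∈ B <;> simp [hz]
  have h := hμ.condExp_comp hp₀ hX heps hY n (F := B.indicator fun _ => 1)
    (measurable_const.indicator hB) (by
      simp only [hmul]
      exact hp₀.integrable.indicator hB)
  simp only [hmul, integral_indicator hB] at h
  exact h

/-- Each history splits into its one-step extensions, whose conditional probabilities are the
predictive ones. -/
theorem condExp_comp_history_succ (hμ : IsPolicyLaw p₀ X eps Y ζ μ) (hp₀ : IsPriorDensity 𝒳 p₀)
    (hX : Measurable X) (heps : Measurable eps) (hY : ∀ n, Measurable (Y n)) (n : ℕ)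
    (φ : (Fin (n + 1) → Resp M) → ℝ) :
    μ[fun ω => φ (history Y (n + 1) ω) | obs Y n]
      =ᵐ[μ] fun ω => ∑ y, predictive (jointPosterior p₀ ζ n (history Y n ω))
        (ζ n (history Y n ω)).regions y * φ (Fin.snoc (history Y n ω) y) := by
  have := hμ.isProbabilityMeasure
  have hφ := integrable_comp_history (μ := μ) hY (n + 1) φ
  refine condExp_obs_eq hY n hφ (fun h => ∑ y, predictive (jointPosterior p₀ ζ n h)
    (ζ n h).regions y * φ (Fin.snoc h y)) fun h => ?_
  have hunion : {ω | history Y n ω = h}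
      = ⋃ y, {ω | history Y (n + 1) ω = (Fin.snoc h y : Fin (n + 1) → Resp M)} := by
    ext ω
    simp [history_succ_eq_iff]
  rw [hunion, integral_iUnion_fintype (fun y => measurableSet_history_eq hY (n + 1) _) ?_
    fun _ => hφ.integrableOn, ← hunion, Finset.mul_sum]
  · refine Finset.sum_congr rfl fun y _ => ?_
    rw [setIntegral_comp_history hY, hμ.real_history_snoc hp₀ hX heps hY, mul_assoc]
  · intro y₁ y₂ hne
    rw [Function.onFun, Set.disjoint_left]
    intro ω e₁ e₂
    exact hne (Fin.snoc_inj.1 (Eq.trans (Eq.symm e₁) e₂)).2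

/-- The conditional expected entropy loss at the prescribed query. -/
theorem sub_condExp_diffEntropy (hμ : IsPolicyLaw p₀ X eps Y ζ μ) (hp₀ : IsPriorDensity 𝒳 p₀)
    (hX : Measurable X) (heps : Measurable eps) (hY : ∀ n, Measurable (Y n)) (n : ℕ) :
    (fun ω => diffEntropy (jointPosterior p₀ ζ n (history Y n ω))) -
        μ[fun ω => diffEntropy (jointPosterior p₀ ζ (n + 1) (history Y (n + 1) ω)) | obs Y n]
      =ᵐ[μ] fun ω => entropyLoss (jointPosterior p₀ ζ n (history Y n ω))
        (ζ n (history Y n ω)).regions := by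
  filter_upwards [hμ.condExp_comp_history_succ hp₀ hX heps hY n
    fun h => diffEntropy (jointPosterior p₀ ζ (n + 1) h)] with ω hω
  simp only [Pi.sub_apply, hω, jointPosterior_snoc]
  rfl

theorem integral_diffEntropy_succ (hμ : IsPolicyLaw p₀ X eps Y ζ μ) (hp₀ : IsPriorDensity 𝒳 p₀)
    (hX : Measurable X) (heps : Measurable eps) (hY : ∀ n, Measurable (Y n)) (n : ℕ) :
    ∫ ω, diffEntropy (jointPosterior p₀ ζ (n + 1) (history Y (n + 1) ω)) ∂μ
      = ∫ ω, diffEntropy (jointPosterior p₀ ζ n (history Y n ω)) ∂μ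
        - ∫ ω, entropyLoss (jointPosterior p₀ ζ n (history Y n ω))
          (ζ n (history Y n ω)).regions ∂μ := by
  have := hμ.isProbabilityMeasure
  rw [← integral_congr_ae (hμ.sub_condExp_diffEntropy hp₀ hX heps hY n)]
  simp only [Pi.sub_apply]
  rw [integral_sub (integrable_comp_history hY n fun h => diffEntropy (jointPosterior p₀ ζ n h))
    integrable_condExp, integral_condExp (measurable_history hY n).comap_le]
  ring

theorem integral_diffEntropy (hμ : IsPolicyLaw p₀ X eps Y ζ μ) (hp₀ : IsPriorDensity 𝒳 p₀)
    (hX : Measurable X) (heps : Measurable eps) (hY : ∀ n, Measurable (Y n)) (N : ℕ) :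
    ∫ ω, diffEntropy (jointPosterior p₀ ζ N (history Y N ω)) ∂μ
      = diffEntropy p₀ - ∑ n ∈ Finset.range N,
        ∫ ω, entropyLoss (jointPosterior p₀ ζ n (history Y n ω))
          (ζ n (history Y n ω)).regions ∂μ := by
  have := hμ.isProbabilityMeasure
  induction N with
  | zero => simp [jointPosterior]
  | succ N ih =>
    rw [hμ.integral_diffEntropy_succ hp₀ hX heps hY, ih, Finset.sum_range_succ]
    ring

theorem condExp_sum_capacity (hμ : IsPolicyLaw p₀ X eps Y ζ μ) (hp₀ : IsPriorDensity 𝒳 p₀)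
    (hX : Measurable X) (heps : Measurable eps) (hY : ∀ n, Measurable (Y n)) (n : ℕ) :
    μ[fun ω => ∑ m, bscCapacity (eps ω m) | obs Y n]
      =ᵐ[μ] fun ω => meanCapacity (jointPosterior p₀ ζ n (history Y n ω)) :=
  hμ.condExp_comp hp₀ hX heps hY n (F := fun z => ∑ m, bscCapacity (z.2 m))
    (Finset.measurable_sum _ fun m _ => continuous_bscCapacity.measurable.comp
      ((measurable_pi_apply m).comp measurable_snd)) hp₀.integrable_sum_capacity_mul

/-- The mean of the maximal gain depends neither on time nor on the policy. -/
theorem integral_meanCapacity (hμ : IsPolicyLaw p₀ X eps Y ζ μ) (hp₀ : IsPriorDensity 𝒳 p₀)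
    (hX : Measurable X) (heps : Measurable eps) (hY : ∀ n, Measurable (Y n)) (n : ℕ) :
    ∫ ω, meanCapacity (jointPosterior p₀ ζ n (history Y n ω)) ∂μ = meanCapacity p₀ := by
  have := hμ.isProbabilityMeasure
  -- Tower property: the posterior mean capacity is a conditional expectation of `∑ C(εₘ)`, whose
  -- mean depends only on the prior.
  rw [← integral_congr_ae (hμ.condExp_sum_capacity hp₀ hX heps hY n),
    integral_condExp (measurable_history hY n).comap_le]
  exact hμ.integral_comp hp₀ hX heps (F := fun z => ∑ m, bscCapacity (z.2 m))
    (Finset.measurable_sum _ fun m _ => continuous_bscCapacity.measurable.comp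
      ((measurable_pi_apply m).comp measurable_snd))

theorem condExp_capacity (hμ : IsPolicyLaw p₀ X eps Y ζ μ) (hp₀ : IsPriorDensity 𝒳 p₀)
    (hX : Measurable X) (heps : Measurable eps) (hY : ∀ n, Measurable (Y n)) (n : ℕ) (m : Fin M) :
    μ[fun ω => bscCapacity (eps ω m) | obs Y n]
      =ᵐ[μ] fun ω => ∫ z, bscCapacity (z.2 m) * jointPosterior p₀ ζ n (history Y n ω) z :=
  hμ.condExp_comp hp₀ hX heps hY n (F := fun z => bscCapacity (z.2 m))
    (continuous_bscCapacity.measurable.comp ((measurable_pi_apply m).comp measurable_snd))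
    (hp₀.integrable_capacity_mul m)

end IsPolicyLaw

end ObservedProcess

/-! ### Policies that feed back the posterior -/

/-- The posterior density when the query is chosen as the function `s` of the posterior density. -/
noncomputable def feedbackPosterior {d M : ℕ} {𝒳 : Set (Fin d → ℝ)}
    (s : (Param d M → ℝ) → JointQuery 𝒳 M) (p₀ : Param d M → ℝ) :
    (n : ℕ) → (Fin n → Resp M) → Param d M → ℝ
  | 0, _ => p₀
  | n + 1, h =>
      bayesUpdate (feedbackPosterior s p₀ n (Fin.init h))
        (s (feedbackPosterior s p₀ n (Fin.init h))).regions (h (Fin.last n))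

/-- The policy that chooses the query as the function `s` of the posterior density. -/
noncomputable def feedbackPolicy {d M : ℕ} {𝒳 : Set (Fin d → ℝ)}
    (s : (Param d M → ℝ) → JointQuery 𝒳 M) (p₀ : Param d M → ℝ) : Policy 𝒳 M :=
  fun n h => s (feedbackPosterior s p₀ n h)

/-- A query that depends on the posterior and a posterior that depends on the policy look circular;
the direct recursion for `feedbackPosterior` breaks the circle, and this lemma closes it again. -/
theorem jointPosterior_feedbackPolicy {d M : ℕ} {𝒳 : Set (Fin d → ℝ)}
    (s : (Param d M → ℝ) → JointQuery 𝒳 M) (p₀ : Param d M → ℝ) (n : ℕ) (h : Fin n → Resp M) :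
    jointPosterior p₀ (feedbackPolicy s p₀) n h = feedbackPosterior s p₀ n h := by
  induction n with
  | zero => rfl
  | succ n ih => rw [jointPosterior, feedbackPosterior, feedbackPolicy, ih]

/-- There are policies whose expected entropy loss is almost maximal at every time. -/
theorem IsPriorDensity.exists_policy_entropyLoss_gt {d M : ℕ} {𝒳 : Set (Fin d → ℝ)}
    {p₀ : Param d M → ℝ} (hp₀ : IsPriorDensity 𝒳 p₀) (hd : 0 < d)
    (h𝒳 : volume (frontier 𝒳) = 0) {δ : ℝ} (hδ : 0 < δ) :
    ∃ ζ : Policy 𝒳 M, ∀ n h, meanCapacity (_root_.jointPosterior p₀ ζ n h) - δ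
      < entropyLoss (_root_.jointPosterior p₀ ζ n h) (ζ n h).regions := by
  -- The selection must be defined on all functions, so those that are not densities receive the
  -- empty query.
  have hex : ∀ p : Param d M → ℝ, ∃ A : JointQuery 𝒳 M,
      IsPriorDensity 𝒳 p → meanCapacity p - δ < entropyLoss p A.regions := by
    intro p
    by_cases hp : IsPriorDensity 𝒳 p
    · obtain ⟨A, hA⟩ := hp.exists_entropyLoss_gt hd h𝒳 (sub_lt_self _ hδ)
      exact ⟨A, fun _ => hA⟩
    · exact ⟨fun _ => ⟨∅, IsQueryRegion.empty⟩, fun h => absurd h hp⟩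
  choose s hs using hex
  refine ⟨feedbackPolicy s p₀, fun n h => ?_⟩
  have h1 := hs _ (hp₀.jointPosterior (feedbackPolicy s p₀) n h)
  have h2 : feedbackPolicy s p₀ n h = s (_root_.jointPosterior p₀ (feedbackPolicy s p₀) n h) := by
    rw [jointPosterior_feedbackPolicy]
    rfl
  rwa [← h2] at h1

/-! ### Optimality at a finite horizon -/

namespace IsPolicyLaw

variable {d M : ℕ} {𝒳 : Set (Fin d → ℝ)} {Ω : Type*} [MeasurableSpace Ω] {μ : Measure Ω}
  {Y : ℕ → Ω → Resp M} {p₀ : Param d M → ℝ} {X : Ω → Fin d → ℝ} {eps : Ω → Fin M → ℝ}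
  {ζ : Policy 𝒳 M}

theorem integral_entropyLoss_le (hμ : IsPolicyLaw p₀ X eps Y ζ μ) (hp₀ : IsPriorDensity 𝒳 p₀)
    (hX : Measurable X) (heps : Measurable eps) (hY : ∀ n, Measurable (Y n)) (n : ℕ) :
    ∫ ω, entropyLoss (jointPosterior p₀ ζ n (history Y n ω)) (ζ n (history Y n ω)).regions ∂μ
      ≤ meanCapacity p₀ := by
  have := hμ.isProbabilityMeasure
  rw [← hμ.integral_meanCapacity hp₀ hX heps hY n]
  refine integral_mono
    (integrable_comp_history hY n fun h => entropyLoss (jointPosterior p₀ ζ n h) (ζ n h).regions)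
    (integrable_comp_history hY n fun h => meanCapacity (jointPosterior p₀ ζ n h)) fun ω => ?_
  exact (hp₀.jointPosterior ζ n _).entropyLoss_le_meanCapacity (JointQuery.measurableSet_regions _)

/-- The loss is at most the maximal gain pointwise, so equal means force equality almost everywhere.
-/
theorem integral_entropyLoss_eq_iff (hμ : IsPolicyLaw p₀ X eps Y ζ μ)
    (hp₀ : IsPriorDensity 𝒳 p₀) (hX : Measurable X) (heps : Measurable eps)
    (hY : ∀ n, Measurable (Y n)) (n : ℕ) :
    ∫ ω, entropyLoss (jointPosterior p₀ ζ n (history Y n ω)) (ζ n (history Y n ω)).regions ∂μ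
        = meanCapacity p₀ ↔
      ∀ᵐ ω ∂μ, entropyLoss (jointPosterior p₀ ζ n (history Y n ω)) (ζ n (history Y n ω)).regions
        = meanCapacity (jointPosterior p₀ ζ n (history Y n ω)) := by
  have := hμ.isProbabilityMeasure
  rw [← hμ.integral_meanCapacity hp₀ hX heps hY n]
  refine integral_eq_iff_of_ae_le
    (integrable_comp_history hY n fun h => entropyLoss (jointPosterior p₀ ζ n h) (ζ n h).regions)
    (integrable_comp_history hY n fun h => meanCapacity (jointPosterior p₀ ζ n h))
    (ae_of_all _ fun ω => ?_)
  exact (hp₀.jointPosterior ζ n _).entropyLoss_le_meanCapacity (JointQuery.measurableSet_regions _)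

end IsPolicyLaw

/-- A policy minimizes the expected entropy at the horizon exactly if its expected entropy loss is
almost surely maximal at each time before. -/
theorem forall_integral_diffEntropy_le_iff {d M : ℕ} {𝒳 : Set (Fin d → ℝ)} (hd : 0 < d)
    (h𝒳 : volume (frontier 𝒳) = 0) {p₀ : Param d M → ℝ} (hp₀ : IsPriorDensity 𝒳 p₀)
    {Ω : Type*} [MeasurableSpace Ω]
    {X : Ω → Fin d → ℝ} {eps : Ω → Fin M → ℝ} {Y : ℕ → Ω → Resp M}
    (hX : Measurable X) (heps : Measurable eps) (hY : ∀ n, Measurable (Y n))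
    {P : Policy 𝒳 M → Measure Ω} (hP : ∀ ζ, IsPolicyLaw p₀ X eps Y ζ (P ζ))
    (N : ℕ) (ζ : Policy 𝒳 M) :
    (∀ ζ' : Policy 𝒳 M,
      ∫ ω, diffEntropy (jointPosterior p₀ ζ N (history Y N ω)) ∂(P ζ)
        ≤ ∫ ω, diffEntropy (jointPosterior p₀ ζ' N (history Y N ω)) ∂(P ζ')) ↔
    ∀ n < N, ∀ᵐ ω ∂(P ζ),
      entropyLoss (jointPosterior p₀ ζ n (history Y n ω)) (ζ n (history Y n ω)).regions
        = meanCapacity (jointPosterior p₀ ζ n (history Y n ω)) := by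
  simp only [fun ζ => (hP ζ).integral_diffEntropy hp₀ hX heps hY N, sub_le_sub_iff_left]
  have hle := fun ζ n => (hP ζ).integral_entropyLoss_le hp₀ hX heps hY n
  constructor
  · intro hmin n hn
    rw [← (hP ζ).integral_entropyLoss_eq_iff hp₀ hX heps hY n]
    refine le_antisymm (hle ζ n) (le_of_forall_pos_le_add fun δ hδ => ?_)
    have hN : (0 : ℝ) < N := by exact_mod_cast n.zero_le.trans_lt hn
    -- A deficit below `δ / N` at each of `N` times costs at most `δ` in total.
    obtain ⟨ζ', hζ'⟩ := hp₀.exists_policy_entropyLoss_gt hd h𝒳 (div_pos hδ hN)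
    have hge : ∀ k, meanCapacity p₀ - δ / N
        ≤ ∫ ω, entropyLoss (jointPosterior p₀ ζ' k (history Y k ω))
          (ζ' k (history Y k ω)).regions ∂(P ζ') := by
      intro k
      have := (hP ζ').isProbabilityMeasure
      have hint := integrable_comp_history (μ := P ζ') hY k
        fun h => meanCapacity (jointPosterior p₀ ζ' k h)
      have h1 : ∫ ω, (meanCapacity (jointPosterior p₀ ζ' k (history Y k ω)) - δ / N) ∂(P ζ')
          = meanCapacity p₀ - δ / N := by
        rw [integral_sub hint (integrable_const _), (hP ζ').integral_meanCapacity hp₀ hX heps hY]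
        simp
      rw [← h1]
      exact integral_mono (hint.sub (integrable_const _)) (integrable_comp_history hY k
        fun h => entropyLoss (jointPosterior p₀ ζ' k h) (ζ' k h).regions)
        fun ω => (hζ' k (history Y k ω)).le
    have hsum' := Finset.sum_le_sum fun k (_ : k ∈ Finset.range N) => hge k
    have hsum := hsum'.trans (hmin ζ')
    rw [Finset.sum_const, Finset.card_range, nsmul_eq_mul, mul_sub, mul_div_cancel₀ _ hN.ne',
      ← Finset.add_sum_erase _ _ (Finset.mem_range.2 hn)] at hsum
    -- The other `N - 1` mean losses are at most `meanCapacity p₀` each, so the total deficit `δ`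
    -- also bounds the deficit at time `n`.
    have hrest := Finset.sum_le_sum fun k (_ : k ∈ (Finset.range N).erase n) => hle ζ k
    rw [Finset.sum_const, nsmul_eq_mul, Finset.card_erase_of_mem (Finset.mem_range.2 hn),
      Finset.card_range, Nat.cast_pred (n.zero_le.trans_lt hn)] at hrest
    linarith
  · intro hopt ζ'
    refine Finset.sum_le_sum fun n hn => (hle ζ' n).trans ?_
    exact (((hP ζ).integral_entropyLoss_eq_iff hp₀ hX heps hY n).2
      (hopt n (Finset.mem_range.1 hn))).ge

theorem theorem6 {d M : ℕ} (hd : 0 < d)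
    (𝒳 : Set (Fin d → ℝ)) (h𝒳 : volume (frontier 𝒳) = 0)
    (p₀ : Param d M → ℝ) (hp₀ : IsPriorDensity 𝒳 p₀)
    {Ω : Type*} [MeasurableSpace Ω]
    (X : Ω → Fin d → ℝ) (eps : Ω → Fin M → ℝ) (Y : ℕ → Ω → Resp M)
    (hX : Measurable X) (heps : Measurable eps) (hY : ∀ n, Measurable (Y n))
    (P : Policy 𝒳 M → Measure Ω) (hP : ∀ ζ, IsPolicyLaw p₀ X eps Y ζ (P ζ)) :
    -- the densities `pₙ` are the posteriors, and `entropyLoss` is the conditional entropy loss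
    (∀ (ζ : Policy 𝒳 M) (n : ℕ),
      (∀ B : Set (Param d M), MeasurableSet B →
        (P ζ)[({ω | (X ω, eps ω) ∈ B}).indicator (fun _ => (1 : ℝ)) | obs Y n]
          =ᵐ[P ζ] fun ω => ∫ θ in B, jointPosterior p₀ ζ n (history Y n ω) θ) ∧
      (fun ω => diffEntropy (jointPosterior p₀ ζ n (history Y n ω))) -
          (P ζ)[fun ω => diffEntropy (jointPosterior p₀ ζ (n + 1) (history Y (n + 1) ω)) | obs Y n]
        =ᵐ[P ζ] fun ω => entropyLoss (jointPosterior p₀ ζ n (history Y n ω))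
          (ζ n (history Y n ω)).regions) ∧
    -- part 1: the formula for the gain, and the characterization of the optimal policies
    (∀ (ζ : Policy 𝒳 M) (n : ℕ), ∀ᵐ ω ∂(P ζ),
      (∀ A : JointQuery 𝒳 M,
        entropyLoss (jointPosterior p₀ ζ n (history Y n ω)) A.regions
          = mixtureGain (jointPosterior p₀ ζ n (history Y n ω)) A.regions) ∧
      IsLUB (range fun A : JointQuery 𝒳 M =>
          mixtureGain (jointPosterior p₀ ζ n (history Y n ω)) A.regions)
        (maxGain 𝒳 (jointPosterior p₀ ζ n (history Y n ω)))) ∧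
    (∀ (N : ℕ) (ζ : Policy 𝒳 M),
      (∀ ζ' : Policy 𝒳 M,
        ∫ ω, diffEntropy (jointPosterior p₀ ζ N (history Y N ω)) ∂(P ζ)
          ≤ ∫ ω, diffEntropy (jointPosterior p₀ ζ' N (history Y N ω)) ∂(P ζ')) ↔
      ∀ n < N, ∀ᵐ ω ∂(P ζ),
        mixtureGain (jointPosterior p₀ ζ n (history Y n ω)) (ζ n (history Y n ω)).regions
          = maxGain 𝒳 (jointPosterior p₀ ζ n (history Y n ω))) ∧
    -- part 2: the value of the maximal gain
    (∀ (ζ : Policy 𝒳 M) (n : ℕ),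
      (∀ᵐ ω ∂(P ζ), maxGain 𝒳 (jointPosterior p₀ ζ n (history Y n ω))
        = ∑ m : Fin M, (P ζ)[fun ω' => bscCapacity (eps ω' m) | obs Y n] ω) ∧
      (∀ m : Fin M, (P ζ)[fun ω' => bscCapacity (eps ω' m) | obs Y n]
        =ᵐ[P ζ] fun ω => ∫ t in Ioo (0 : ℝ) (1 / 2),
          bscCapacity t * epsMarginal (jointPosterior p₀ ζ n (history Y n ω)) m t)) := by
  -- All response probabilities being positive, these facts hold for every history, not merely
  -- almost every one.
  have hpost : ∀ (ζ : Policy 𝒳 M) n h, IsPriorDensity 𝒳 (jointPosterior p₀ ζ n h) :=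
    hp₀.jointPosterior
  have hmax : ∀ (ζ : Policy 𝒳 M) n h, maxGain 𝒳 (jointPosterior p₀ ζ n h)
      = meanCapacity (jointPosterior p₀ ζ n h) := fun ζ n h => (hpost ζ n h).maxGain_eq hd h𝒳
  have hgain : ∀ (ζ : Policy 𝒳 M) n h (A : JointQuery 𝒳 M),
      entropyLoss (jointPosterior p₀ ζ n h) A.regions
        = mixtureGain (jointPosterior p₀ ζ n h) A.regions := fun ζ n h A =>
    (hpost ζ n h).entropyLoss_eq_mixtureGain A.measurableSet_regions
  refine ⟨fun ζ n => ⟨fun B hB => (hP ζ).condExp_indicator hp₀ hX heps hY n hB,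
    (hP ζ).sub_condExp_diffEntropy hp₀ hX heps hY n⟩, fun ζ n => ae_of_all _ fun ω =>
      ⟨hgain ζ n _, ?_⟩, fun N ζ => ?_, fun ζ n => ⟨?_, fun m => ?_⟩⟩
  · simp only [← hgain, hmax]
    exact (hpost ζ n _).isLUB_entropyLoss hd h𝒳
  · simp only [← hgain, hmax]
    exact forall_integral_diffEntropy_le_iff hd h𝒳 hp₀ hX heps hY hP N ζ
  · filter_upwards [ae_all_iff.2 fun m => (hP ζ).condExp_capacity hp₀ hX heps hY n m] with ω hω
    rw [hmax, (hpost ζ n _).meanCapacity_eq_sum]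
    exact Finset.sum_congr rfl fun m _ => (hω m).symm
  · filter_upwards [(hP ζ).condExp_capacity hp₀ hX heps hY n m] with ω hω
    rw [hω, (hpost ζ n _).integral_mul_epsMarginal]
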